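/- Let $R$ be a one-dimensional excellent henselian local domain with field of fractions $Q$, let $S$ be the integral closure of $R$ in $Q$, and let $\mathfrak c = R:_Q S=\{x\in Q \mid xS\subseteq R\}$ be the conductor, an ideal of $R$. (Excellent means: noetherian, universally catenary, with geometrically regular formal fibres, and such that every finitely generated $R$-algebra has open regular locus.) Let $\operatorname{mod} R$ be the category of finitely generated $R$-modules. A subcategory of $\operatorname{mod} R$ means a nonempty full subcategory closed under isomorphisms. Denote by $0$, $\operatorname{fl} R$ and $\operatorname{tf} R$ the subcategories of $\operatorname{mod} R$ of zero modules, of modules of finite length, and of torsionfree modules, respectively. For a finitely generated $R$-module $M$ let $\operatorname{ext}_R M$ be the smallest subcategory of $\operatorname{mod} R$ that contains $M$ and is closed under direct summands and extensions. A subcategory $\mathcal X$ is called Hom-ideal if $\operatorname{Hom}_R(M,X)\in\mathcal X$ for all $M\in\operatorname{mod} R$ and $X\in\mathcal X$. It is called IKE-closed if it is closed under extensions and contains the image and the kernel of every $R$-homomorphism between two of its objects. Then the following hold. (1) $S$ is a finitely generated $R$-module, and if $\mathcal X$ is a Hom-ideal subcategory of $\operatorname{mod} R$ that is closed under direct summands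 and contains a nonzero torsionfree $R$-module, then $\mathcal X$ contains the $R$-module $S$. (2) If $\operatorname{ext}_R \mathfrak c=\operatorname{tf} R$, then the IKE-closed subcategories of $\operatorname{mod} R$ are exactly $0$, $\operatorname{fl} R$, $\operatorname{tf} R$ and $\operatorname{mod} R$. In particular, every IKE-closed subcategory of $\operatorname{mod} R$ is then closed under submodules and extensions. -/

import Mathlib

open CategoryTheory TensorProduct

universe u v

/-! ### Excellent rings -/

/-- An algebra `A` over a field `k` is geometrically regular if `L ⊗[k] A` is a (noetherian)
regular ring for every finite field extension `L` of `k`. -/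
def IsGeometricallyRegular (k : Type u) (A : Type v) [Field k] [CommRing A] [Algebra k A] : Prop :=
  ∀ (L : Type u) [Field L] [Algebra k L] [FiniteDimensional k L], IsRegularRing (L ⊗[k] A)

/-- The structure map `A → B` of an algebra is a regular homomorphism: it is flat and all its
fibres `κ(p) ⊗[A] B` are geometrically regular over `κ(p)`. -/
structure IsRegularAlgebra (A : Type u) (B : Type v) [CommRing A] [CommRing B] [Algebra A B] :
    Prop where
  flat : Module.Flat A B
  fiber : ∀ (p : Ideal A) [p.IsPrime], IsGeometricallyRegular p.ResidueField (p.Fiber B)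

/-- The formal fibres condition (Grothendieck rings): for every prime `p`, the map from the
local ring `R_p` to its completion is regular. -/
def HasRegularFormalFibers (R : Type u) [CommRing R] : Prop :=
  ∀ (p : Ideal R) [p.IsPrime],
    IsRegularAlgebra (Localization.AtPrime p)
      (AdicCompletion (IsLocalRing.maximalIdeal (Localization.AtPrime p))
        (Localization.AtPrime p))

/-- The regular locus of a ring. -/
def regularLocus (A : Type u) [CommRing A] : Set (PrimeSpectrum A) :=
  {p | IsRegularLocalRing (Localization.AtPrime p.asIdeal)}

/-- A (noetherian) ring is catenary if any two saturated chains of primes with the same ends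
have the same length. -/
def IsCatenaryRing (A : Type u) [CommRing A] : Prop :=
  ∀ x y : RelSeries {pq : PrimeSpectrum A × PrimeSpectrum A | pq.1 ⋖ pq.2},
    x.head = y.head → x.last = y.last → x.length = y.length

/-- Excellent rings: noetherian rings that are universally catenary, have geometrically regular
formal fibres, and all of whose finitely generated algebras have open regular locus. -/
class IsExcellentRing (R : Type u) [CommRing R] : Prop extends IsNoetherianRing R where
  universally_catenary : ∀ (A : Type u) [CommRing A] [Algebra R A] [Algebra.FiniteType R A],
    IsCatenaryRing A
  regular_formal_fibers : HasRegularFormalFibers R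
  isOpen_regularLocus : ∀ (A : Type u) [CommRing A] [Algebra R A] [Algebra.FiniteType R A],
    IsOpen (regularLocus A)

/-! ### Normalization and conductor of a domain -/

/-- The normalization of a domain: its integral closure in its field of fractions. -/
abbrev Normalization (R : Type u) [CommRing R] [IsDomain R] :
    Subalgebra R (FractionRing R) :=
  integralClosure R (FractionRing R)

/-- The conductor `R :_Q S = {x ∈ Q | x S ⊆ R}`, where `S` is the normalization of `R` and `Q` the
field of fractions, as an ideal of `R` (it is contained in `R` since `1 ∈ S`,
see `map_conductorIdeal`). -/
noncomputable def conductorIdeal (R : Type u) [CommRing R] [IsDomain R] : Ideal R :=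
  ((1 : Submodule R (FractionRing R)) / Subalgebra.toSubmodule (Normalization R)).comap
    (Algebra.linearMap R (FractionRing R))

theorem map_conductorIdeal (R : Type u) [CommRing R] [IsDomain R] :
    Submodule.map (Algebra.linearMap R (FractionRing R)) (conductorIdeal R) =
      (1 : Submodule R (FractionRing R)) / Subalgebra.toSubmodule (Normalization R) := by
  refine (Submodule.map_comap_eq _ _).trans (inf_eq_right.2 fun x hx => ?_)
  have h := Submodule.mem_div_iff_forall_mul_mem.1 hx 1 (one_mem (Normalization R))
  rw [mul_one] at h
  rwa [Submodule.one_eq_range] at h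

/-! ### Subcategories of the category `mod R` of finitely generated modules

A strictly full subcategory is a property of finitely generated modules that is invariant under
isomorphism. -/

instance Module.Finite.linearMap_of_isNoetherianRing {R : Type u} [CommRing R] [IsNoetherianRing R]
    (M N : Type v) [AddCommGroup M] [Module R M] [Module.Finite R M]
    [AddCommGroup N] [Module R N] [Module.Finite R N] : Module.Finite R (M →ₗ[R] N) := by
  obtain ⟨n, f, hf⟩ := Module.Finite.exists_fin' R M
  exact Module.Finite.of_injective (f.lcomp R N) fun g h e =>
    LinearMap.ext fun x => by
      obtain ⟨y, rfl⟩ := hf x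
      exact LinearMap.congr_fun e y

namespace ModSubcategory

variable {R : Type u} [CommRing R]

/-- Closed under direct summands: if `X ≅ Y ⊕ Z` is in the subcategory, so is `Y`. -/
def ClosedUnderSummands (𝒳 : ObjectProperty (FGModuleCat.{u} R)) : Prop :=
  ∀ (X Y Z : FGModuleCat.{u} R) (_ : X ≃ₗ[R] (Y × Z)), 𝒳 X → 𝒳 Y

/-- Closed under extensions: for an exact sequence `0 → L → M → N → 0`, if `L` and `N` are in the
subcategory, so is `M`. -/
def ClosedUnderExtensions (𝒳 : ObjectProperty (FGModuleCat.{u} R)) : Prop :=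
  ∀ (L M N : FGModuleCat.{u} R) (f : L →ₗ[R] M) (g : M →ₗ[R] N),
    Function.Injective f → Function.Exact f g → Function.Surjective g → 𝒳 L → 𝒳 N → 𝒳 M

/-- Closed under subobjects. -/
def ClosedUnderSubobjects [IsNoetherianRing R] (𝒳 : ObjectProperty (FGModuleCat.{u} R)) : Prop :=
  ∀ (X : FGModuleCat.{u} R) (Y : Submodule R X), 𝒳 X → 𝒳 (FGModuleCat.of R Y)

/-- Closed under kernels of homomorphisms between objects of the subcategory. -/
def ClosedUnderKernels [IsNoetherianRing R] (𝒳 : ObjectProperty (FGModuleCat.{u} R)) : Prop :=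
  ∀ (X Y : FGModuleCat.{u} R) (f : X →ₗ[R] Y), 𝒳 X → 𝒳 Y →
    𝒳 (FGModuleCat.of R (LinearMap.ker f))

/-- Closed under images of homomorphisms between objects of the subcategory. -/
def ClosedUnderImages (𝒳 : ObjectProperty (FGModuleCat.{u} R)) : Prop :=
  ∀ (X Y : FGModuleCat.{u} R) (f : X →ₗ[R] Y), 𝒳 X → 𝒳 Y →
    𝒳 (FGModuleCat.of R (LinearMap.range f))

/-- Hom-ideal: `Hom_R(M, X)` is in the subcategory for all `M` in `mod R` and all `X` in the
subcategory. -/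
def HomIdeal [IsNoetherianRing R] (𝒳 : ObjectProperty (FGModuleCat.{u} R)) : Prop :=
  ∀ M X : FGModuleCat.{u} R, 𝒳 X → 𝒳 (FGModuleCat.of R (M →ₗ[R] X))

/-- An IKE-closed subcategory: a (nonempty, strictly full) subcategory of `mod R` closed under
images, kernels and extensions. -/
structure IsIKEClosed [IsNoetherianRing R] (𝒳 : ObjectProperty (FGModuleCat.{u} R)) : Prop where
  nonempty : ∃ X, 𝒳 X
  iso : 𝒳.IsClosedUnderIsomorphisms
  images : ClosedUnderImages 𝒳
  kernels : ClosedUnderKernels 𝒳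
  extensions : ClosedUnderExtensions 𝒳

/-- A torsionfree subcategory: one closed under subobjects and extensions. -/
structure IsTorsionfree [IsNoetherianRing R] (𝒳 : ObjectProperty (FGModuleCat.{u} R)) : Prop where
  nonempty : ∃ X, 𝒳 X
  iso : 𝒳.IsClosedUnderIsomorphisms
  subobjects : ClosedUnderSubobjects 𝒳
  extensions : ClosedUnderExtensions 𝒳

variable (R)

/-- The zero subcategory of `mod R`. -/
def zero : ObjectProperty (FGModuleCat.{u} R) := fun M => Subsingleton M

/-- The subcategory `fl R` of modules of finite length. -/
def fl : ObjectProperty (FGModuleCat.{u} R) := fun M => IsFiniteLength R M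

/-- The subcategory `tf R` of torsionfree modules. -/
def tf : ObjectProperty (FGModuleCat.{u} R) := fun M => Module.IsTorsionFree R M

variable {R}

/-- The extension closure `ext_R M`: the smallest (strictly full) subcategory of `mod R` that
contains `M` and is closed under direct summands and extensions. -/
def ext (M : FGModuleCat.{u} R) : ObjectProperty (FGModuleCat.{u} R) := fun N =>
  ∀ 𝒴 : ObjectProperty (FGModuleCat.{u} R), 𝒴.IsClosedUnderIsomorphisms → 𝒴 M →
    ClosedUnderSummands 𝒴 → ClosedUnderExtensions 𝒴 → 𝒴 N

end ModSubcategory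

/-! Finiteness of `S` is a descent from the completion `B` of `R`. Fix `x ≠ 0` in the maximal ideal.
As in the Krull-Akizuki theorem, `S / xS` is finitely generated, because in dimension one the length
of `R / xR` bounds the lengths of its finitely generated submodules. Excellence makes the generic
formal fibre `B ⊗ Q` regular; it is also zero-dimensional, being obtained from `B` by inverting `x`,
so it is semisimple. Hence `B ⊗ S` is separated: its elements divisible by every power of `x` form
an ideal of `B ⊗ Q`, generated by an idempotent `e` with `e / x` integral over `B`, and Nakayama's
lemma forces `e = 0`. Nakayama's lemma over the complete ring `B` now lifts generators of `S / xS`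
to generators of `B ⊗ S`, and faithful flatness brings them down to `S`.

Given finiteness, `S` is a Dedekind domain with finitely many maximal ideals, hence a principal
ideal domain. For `X` nonzero torsionfree, `Hom_R(S, X)` is a nonzero finitely generated torsionfree
`S`-module, so it is free and has `S` as a summand; this is (1). The conductor is a nonzero ideal of
`S`, so it is isomorphic to `S`.

For (2), an IKE-closed subcategory is closed under summands and is Hom-ideal. An object of infinite
length yields a nonzero torsionfree object, hence `S`, hence the conductor, hence all of `tf R`. An
object with torsion yields the residue field, hence all of `fl R`. Every module is an extension of a
torsionfree module by one of finite length, so only four cases remain, and each of these is closed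
under submodules and extensions. -/

/-! ### Lengths of quotients by a nonzero element in dimension one -/

/-- An ideal `J` of a one-dimensional noetherian domain satisfies
`length (J / xJ) ≤ length (R / xR)`. -/
theorem Ideal.length_quotient_smul_top_le {R : Type*} [CommRing R] [IsDomain R] [IsNoetherianRing R]
    [Ring.KrullDimLE 1 R] {x : R} (hx : x ≠ 0) (J : Ideal R) :
    Module.length R (J ⧸ LinearMap.range (LinearMap.lsmul R J x)) ≤
      Module.length R (R ⧸ Ideal.span {x}) := by
  by_cases hJ : J = ⊥
  · subst hJ
    have : Subsingleton ((⊥ : Ideal R) ⧸ LinearMap.range (LinearMap.lsmul R (⊥ : Ideal R) x)) :=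
      (Submodule.mkQ_surjective _).subsingleton
    simp [Module.length_eq_zero]
  obtain ⟨a, ha, ha0⟩ := Submodule.exists_mem_ne_zero_of_ne_bot hJ
  -- Two expressions for the length of `R / xJ` are compared below; cancelling their common term
  -- `length (R / J)` requires it to be finite.
  have hfin : Module.length R (R ⧸ J) ≠ ⊤ := by
    have h1 := isFiniteLength_quotient_span_singleton R (mem_nonZeroDivisors_of_ne_zero ha0)
    rw [← Module.length_ne_top_iff] at h1
    refine ne_top_of_le_ne_top h1 (Module.length_le_of_surjective
      (Submodule.factor (show Ideal.span {a} ≤ J by simpa [Ideal.span_le] using ha))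
      (Submodule.factor_surjective _))
  -- `R / xJ` is filtered in two ways
  let xJ : Submodule R R := Submodule.map (LinearMap.lsmul R R x) J
  have hle1 : xJ ≤ J := by
    rintro _ ⟨j, hj, rfl⟩
    exact J.mul_mem_left x hj
  have hle2 : xJ ≤ Ideal.span {x} := by
    rintro _ ⟨j, hj, rfl⟩
    exact Ideal.mul_mem_right _ _ (Ideal.mem_span_singleton_self x)
  have e1 : Module.length R (R ⧸ xJ) =
      Module.length R (J ⧸ LinearMap.range (LinearMap.lsmul R J x)) +
        Module.length R (R ⧸ J) := by
    have hr : LinearMap.range (LinearMap.lsmul R J x) ≤ xJ.comap J.subtype := by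
      rintro _ ⟨j, rfl⟩
      exact ⟨j, j.2, rfl⟩
    refine Module.length_eq_add_of_exact
      (Submodule.mapQ _ xJ J.subtype hr) (Submodule.factor hle1) ?_
      (Submodule.factor_surjective _) ?_
    · rw [← LinearMap.ker_eq_bot, Submodule.ker_mapQ, ← le_bot_iff]
      rintro _ ⟨⟨j, hj⟩, ⟨i, hi, hij⟩, rfl⟩
      simp only [Submodule.mem_bot, Submodule.mkQ_apply, Submodule.Quotient.mk_eq_zero]
      exact ⟨⟨i, hi⟩, Subtype.ext hij⟩
    · intro y
      obtain ⟨y, rfl⟩ := Submodule.mkQ_surjective _ y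
      change (Submodule.Quotient.mk y : R ⧸ J) = 0 ↔ _
      constructor
      · intro hy
        exact ⟨Submodule.Quotient.mk ⟨y, (Submodule.Quotient.mk_eq_zero J).1 hy⟩, rfl⟩
      · rintro ⟨z, hz⟩
        obtain ⟨z, rfl⟩ := Submodule.mkQ_surjective _ z
        have := (Submodule.Quotient.eq _).1 hz
        have h2 := J.sub_mem z.2 (hle1 this)
        exact (Submodule.Quotient.mk_eq_zero J).2 (by simpa using h2)
  have e2 : Module.length R (R ⧸ xJ) =
      Module.length R (R ⧸ J) + Module.length R (R ⧸ Ideal.span {x}) := by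
    have hr : (J : Submodule R R) ≤ xJ.comap (LinearMap.lsmul R R x) :=
      fun j hj => Submodule.mem_map_of_mem hj
    refine Module.length_eq_add_of_exact
      (Submodule.mapQ (J : Submodule R R) xJ (LinearMap.lsmul R R x) hr)
      (Submodule.factor hle2) ?_ (Submodule.factor_surjective _) ?_
    · rw [← LinearMap.ker_eq_bot, Submodule.ker_mapQ, ← le_bot_iff]
      rintro _ ⟨j, ⟨i, hi, hij⟩, rfl⟩
      simp only [Submodule.mem_bot, Submodule.mkQ_apply, Submodule.Quotient.mk_eq_zero]
      simp only [LinearMap.lsmul_apply, smul_eq_mul] at hij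
      rwa [← mul_left_cancel₀ hx hij]
    · intro y
      obtain ⟨y, rfl⟩ := Submodule.mkQ_surjective _ y
      change (Submodule.Quotient.mk y : R ⧸ Ideal.span {x}) = 0 ↔ _
      constructor
      · intro hy
        obtain ⟨z, rfl⟩ := Ideal.mem_span_singleton.1 ((Submodule.Quotient.mk_eq_zero _).1 hy)
        exact ⟨Submodule.Quotient.mk z, rfl⟩
      · rintro ⟨z, hz⟩
        obtain ⟨z, rfl⟩ := Submodule.mkQ_surjective _ z
        have h3 := hle2 ((Submodule.Quotient.eq _).1 hz)
        have h2 := Ideal.sub_mem _ (Ideal.mul_mem_right z _ (Ideal.mem_span_singleton_self x)) h3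
        exact (Submodule.Quotient.mk_eq_zero _).2 (by simpa using h2)
  rw [e1, add_comm] at e2
  exact (WithTop.add_left_cancel hfin e2).le

/-- A finitely generated submodule of the field of fractions embeds into the ring. -/
theorem Submodule.exists_injective_of_fg {R : Type*} [CommRing R] [IsDomain R]
    {K : Type*} [Field K] [Algebra R K] [IsFractionRing R K] (M : Submodule R K) (hM : M.FG) :
    ∃ φ : M →ₗ[R] R, Function.Injective φ := by
  obtain ⟨d, hd, h⟩ : ∃ d : R, d ≠ 0 ∧ ∀ m ∈ M, IsLocalization.IsInteger R (d • m) := by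
    obtain ⟨s, rfl⟩ := hM
    obtain ⟨⟨b, hb⟩, hs⟩ := IsLocalization.exist_integer_multiples_of_finset (nonZeroDivisors R) s
    refine ⟨b, nonZeroDivisors.ne_zero hb, fun m hm => ?_⟩
    induction hm using Submodule.span_induction with
    | mem m hm => exact hs m hm
    | zero => exact ⟨0, by simp⟩
    | add y z _ _ hy hz =>
      rw [smul_add]; exact IsLocalization.isInteger_add hy hz
    | smul r y _ hy =>
      rw [smul_comm]; exact IsLocalization.isInteger_smul hy
  have hinj : Function.Injective (Algebra.linearMap R K) := IsFractionRing.injective R K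
  let φ : M →ₗ[R] R := (LinearEquiv.ofInjective _ hinj).symm.toLinearMap ∘ₗ
    (LinearMap.lsmul R K d ∘ₗ M.subtype).codRestrict _ fun m => h m m.2
  have hφ : Function.Injective φ := by
    refine (LinearEquiv.injective (LinearEquiv.ofInjective _ hinj).symm).comp fun a b hab => Subtype.ext ?_
    exact smul_right_injective K hd (congrArg Subtype.val hab)
  exact ⟨φ, hφ⟩

/-- A common denominator identifies `M` with an ideal, for which the bound is known. -/
theorem Submodule.length_quotient_smul_le_of_fg {R : Type*} [CommRing R] [IsDomain R]
    [IsNoetherianRing R] [Ring.KrullDimLE 1 R] {K : Type*} [Field K] [Algebra R K]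
    [IsFractionRing R K] {x : R} (hx : x ≠ 0) (M : Submodule R K) (hM : M.FG) :
    Module.length R (M ⧸ LinearMap.range (LinearMap.lsmul R M x)) ≤
      Module.length R (R ⧸ Ideal.span {x}) := by
  obtain ⟨φ, hφ⟩ := M.exists_injective_of_fg hM
  let e := LinearEquiv.ofInjective φ hφ
  let J : Ideal R := LinearMap.range φ
  let g : J →ₗ[R] M := e.symm.toLinearMap
  have hgs : Function.Surjective g := e.symm.surjective
  refine le_trans (Module.length_le_of_surjective
    (Submodule.mapQ (LinearMap.range (LinearMap.lsmul R J x)) _ g ?_) ?_)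
    (Ideal.length_quotient_smul_top_le hx J)
  · rintro _ ⟨j, rfl⟩
    exact ⟨g j, by simp⟩
  · intro y
    obtain ⟨y, rfl⟩ := Submodule.mkQ_surjective _ y
    obtain ⟨j, rfl⟩ := hgs y
    exact ⟨Submodule.Quotient.mk j, rfl⟩

/-- A module whose finitely generated submodules have bounded length is finitely generated. -/
theorem Module.Finite.of_length_le {R : Type*} [CommRing R] {W : Type*} [AddCommGroup W] [Module R W]
    (n : ℕ) (h : ∀ V : Submodule R W, V.FG → Module.length R V ≤ n) : Module.Finite R W := by
  classical
  have hfin : ∀ V : Submodule R W, V.FG → ∃ k : ℕ, Module.length R V = k := fun V hV => by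
    obtain ⟨k, hk⟩ := ENat.ne_top_iff_exists.1 (ne_top_of_le_ne_top (ENat.natCast_ne_top n) (h V hV))
    exact ⟨k, hk.symm⟩
  -- Choose a finitely generated `V` of maximal length; adjoining an element outside `V` would give
  -- a longer one.
  let P : ℕ → Prop := fun k => ∃ V : Submodule R W, V.FG ∧ Module.length R V = k
  have hP0 : P 0 := ⟨⊥, Submodule.fg_bot, by simp⟩
  have hPn : ∀ k, P k → k ≤ n := by
    rintro k ⟨V, hV, hk⟩
    have := h V hV
    rw [hk] at this
    exact_mod_cast this
  obtain ⟨V, hV, hk⟩ : P (Nat.findGreatest P n) := Nat.findGreatest_spec (Nat.zero_le n) hP0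
  refine ⟨?_⟩
  convert hV
  symm
  rw [eq_top_iff]
  intro w _
  by_contra hw
  have hV' : (V ⊔ Submodule.span R {w}).FG := hV.sup (Submodule.fg_span_singleton w)
  obtain ⟨k, hk'⟩ := hfin _ hV'
  have h1 : k ≤ Nat.findGreatest P n := Nat.le_findGreatest (hPn k ⟨_, hV', hk'⟩) ⟨_, hV', hk'⟩
  have hlt : V < V ⊔ Submodule.span R {w} := by
    refine lt_of_le_of_ne le_sup_left fun he => hw ?_
    rw [he]
    exact Submodule.mem_sup_right (Submodule.mem_span_singleton_self w)
  have h2 := Module.length_eq_add_of_exact (Submodule.inclusion hlt.le)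
    (LinearMap.range (Submodule.inclusion hlt.le)).mkQ (Submodule.inclusion_injective _)
    (Submodule.mkQ_surjective _) (LinearMap.exact_map_mkQ_range _)
  have h3 : 0 < Module.length R
      (↥(V ⊔ Submodule.span R {w}) ⧸ LinearMap.range (Submodule.inclusion hlt.le)) := by
    rw [Module.length_pos_iff, Submodule.Quotient.nontrivial_iff, Submodule.range_inclusion]
    intro ht
    refine hlt.not_ge fun y hy => ?_
    have : (⟨y, hy⟩ : ↥(V ⊔ Submodule.span R {w})) ∈
      Submodule.comap (V ⊔ Submodule.span R {w}).subtype V := ht ▸ Submodule.mem_top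
    exact this
  rw [hk, hk'] at h2
  have h4 : ((Nat.findGreatest P n : ℕ) : ℕ∞) < k := by
    rw [h2]
    exact (ENat.add_lt_add_iff_left (ENat.natCast_ne_top _)).2 h3 |>.trans_le' (by simp)
  exact absurd h1 (not_le.2 (by exact_mod_cast h4))

/-- The finiteness part of the Krull-Akizuki theorem: `S / xS` is finitely generated for every
submodule `S` of the field of fractions. -/
theorem Submodule.finite_quotient_range_lsmul {R : Type*} [CommRing R] [IsDomain R]
    [IsNoetherianRing R] [Ring.KrullDimLE 1 R] {K : Type*} [Field K] [Algebra R K]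
    [IsFractionRing R K] {x : R} (hx : x ≠ 0) (S : Submodule R K) :
    Module.Finite R (S ⧸ LinearMap.range (LinearMap.lsmul R S x)) := by
  have hfl := isFiniteLength_quotient_span_singleton R (mem_nonZeroDivisors_of_ne_zero hx)
  rw [← Module.length_ne_top_iff] at hfl
  obtain ⟨n, hn⟩ := ENat.ne_top_iff_exists.1 hfl
  refine Module.Finite.of_length_le n fun V hV => ?_
  rw [hn]
  -- Lift `V` to a finitely generated `M` inside `S`. Since `x` kills `S / xS`, the quotient `M /
  -- xM` maps onto `V`, and its length is bounded independently of `M`.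
  obtain ⟨M, hM, rfl⟩ : ∃ M : Submodule R S, M.FG ∧
      M.map (LinearMap.range (LinearMap.lsmul R S x)).mkQ = V := by
    classical
    obtain ⟨s, rfl⟩ := hV
    refine ⟨Submodule.span R (s.image (Function.surjInv (Submodule.mkQ_surjective _))), ⟨_, rfl⟩, ?_⟩
    rw [Submodule.map_span, Finset.coe_image, ← Set.image_comp,
      (Function.rightInverse_surjInv _).comp_eq_id, Set.image_id]
  have hx0 : ∀ w : S ⧸ LinearMap.range (LinearMap.lsmul R S x), x • w = 0 := by
    intro w
    obtain ⟨w, rfl⟩ := Submodule.mkQ_surjective _ w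
    exact (Submodule.Quotient.mk_eq_zero _).2 ⟨w, rfl⟩
  refine le_trans ?_ (Submodule.length_quotient_smul_le_of_fg (K := K) hx (M.map S.subtype)
    (hM.map _))
  let f : M.map S.subtype →ₗ[R] (M.map (LinearMap.range (LinearMap.lsmul R S x)).mkQ) :=
    ((LinearMap.range (LinearMap.lsmul R S x)).mkQ.submoduleMap M) ∘ₗ
      (Submodule.equivMapOfInjective S.subtype S.injective_subtype M).symm.toLinearMap
  have hf : Function.Surjective f :=
    (LinearMap.submoduleMap_surjective _ _).comp (LinearEquiv.surjective _)
  refine Module.length_le_of_surjective (Submodule.liftQ _ f ?_) ?_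
  · rintro _ ⟨m, rfl⟩
    rw [LinearMap.lsmul_apply, LinearMap.mem_ker, map_smul]
    exact Subtype.ext (hx0 _)
  · intro y
    obtain ⟨m, rfl⟩ := hf y
    exact ⟨Submodule.Quotient.mk m, rfl⟩

/-! ### Complete rings -/

theorem IsPrecomplete.pi_fin {B : Type*} [CommRing B] (I : Ideal B) [IsPrecomplete I B] (k : ℕ) :
    IsPrecomplete I (Fin k → B) := by
  rw [← AdicCompletion.of_surjective_iff]
  intro y
  have h := AdicCompletion.of_surjective I B
  choose z hz using fun i => h (AdicCompletion.piEquivFin I k y i)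
  refine ⟨z, (AdicCompletion.piEquivFin I k).injective ?_⟩
  funext i
  rw [← hz i, AdicCompletion.piEquivFin_apply]
  rfl

/-- Nakayama's lemma over a complete ring: a separated module which is finitely generated modulo
`I` is finitely generated, by the same generators. -/
theorem Submodule.span_range_eq_top_of_isPrecomplete {B : Type*} [CommRing B] (I : Ideal B)
    [IsPrecomplete I B] {N : Type*} [AddCommGroup N] [Module B N] [IsHausdorff I N] {k : ℕ}
    (s : Fin k → N) (h : Submodule.span B (Set.range s) ⊔ I • ⊤ = ⊤) :
    Submodule.span B (Set.range s) = ⊤ := by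
  have := IsPrecomplete.pi_fin I k
  rw [← Fintype.range_linearCombination, LinearMap.range_eq_top]
  apply surjective_of_mkQ_comp_surjective (I := I)
  rw [← LinearMap.range_eq_top, LinearMap.range_comp, Fintype.range_linearCombination,
    Submodule.map_mkQ_eq_top, sup_comm, h]

/-- If `x` lies in the Jacobson radical of `B` and is invertible in `F`, then an idempotent `e` of
`F` such that `e / x` is integral over `B` vanishes. -/
theorem IsIdempotentElem.eq_zero_of_isIntegral_div {B F : Type*} [CommRing B] [CommRing F]
    [Algebra B F] {x : B} (hx : x ∈ Ideal.jacobson (⊥ : Ideal B)) {w e : F}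
    (hw : algebraMap B F x * w = 1) (he : e * e = e) (hi : IsIntegral B (e * w)) : e = 0 := by
  -- With `w = 1 / x`, the module `M = e B[ew]` is finitely generated by integrality and satisfies
  -- `M = xM`, because `e a = x · e (e w a)`. Nakayama's lemma gives `M = 0`, and `e` lies in `M`.
  let M : Submodule B F := (Subalgebra.toSubmodule (Algebra.adjoin B {e * w})).map
    (LinearMap.mulLeft B e)
  have hM : M.FG := (hi.fg_adjoin_singleton).map _
  have h1 : M ≤ Ideal.span {x} • M := by
    rintro _ ⟨a, ha, rfl⟩
    have : LinearMap.mulLeft B e a = x • LinearMap.mulLeft B e (e * w * a) := by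
      simp only [LinearMap.mulLeft_apply, Algebra.smul_def]
      linear_combination (-e * e * a) * hw - a * he
    rw [this]
    exact Submodule.smul_mem_smul (Ideal.mem_span_singleton_self x)
      ⟨_, (Algebra.adjoin B {e * w}).mul_mem
      (Algebra.self_mem_adjoin_singleton B (e * w)) ha, rfl⟩
  have h2 := Submodule.eq_bot_of_le_smul_of_le_jacobson_bot _ M hM h1
    (by simpa [Ideal.span_le] using hx)
  have h3 : e ∈ M := ⟨1, (Algebra.adjoin B {e * w}).one_mem, by simp⟩
  rwa [h2] at h3

theorem IsHausdorff.of_linearMap_injective {B : Type*} [CommRing B] (I : Ideal B) {M N : Type*}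
    [AddCommGroup M] [Module B M] [AddCommGroup N] [Module B N] [IsHausdorff I N] (f : M →ₗ[B] N)
    (hf : Function.Injective f) : IsHausdorff I M := by
  refine ⟨fun x hx => hf ?_⟩
  rw [map_zero]
  refine IsHausdorff.haus' (I := I) _ fun n => ?_
  have h := hx n
  rw [SModEq.zero] at h ⊢
  have h1 := Submodule.mem_map_of_mem (f := f) h
  rw [Submodule.map_smul''] at h1
  exact Submodule.smul_mono le_rfl le_top h1

theorem Submodule.eq_top_of_sup_smul_top_of_isPrecomplete {B : Type*} [CommRing B] (I : Ideal B)
    [IsPrecomplete I B] {N : Type*} [AddCommGroup N] [Module B N] [IsHausdorff I N]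
    (V : Submodule B N) (hV : V.FG) (h : V ⊔ I • ⊤ = ⊤) : V = ⊤ := by
  obtain ⟨k, s, rfl⟩ := Submodule.fg_iff_exists_fin_generating_family.1 hV
  exact Submodule.span_range_eq_top_of_isPrecomplete I s h

/-! ### Local rings whose maximal ideal is nilpotent modulo one element. -/

section CompleteLocal

variable {B : Type*} [CommRing B] [IsLocalRing B]

open IsLocalRing

theorem IsLocalRing.eq_maximalIdeal_of_pow_le_span {x : B} {k : ℕ}
    (hk : maximalIdeal B ^ k ≤ Ideal.span {x}) {P : Ideal B} (hP : P.IsPrime) (hx : x ∈ P) :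
    P = maximalIdeal B :=
  le_antisymm (le_maximalIdeal hP.ne_top)
    (hP.le_of_pow_le (hk.trans ((Ideal.span_singleton_le_iff_mem _).2 hx)))

/-- A complete local ring with finitely generated maximal ideal that is nilpotent modulo a
principal ideal is noetherian. -/
theorem IsLocalRing.isNoetherianRing_of_pow_le_span [IsAdicComplete (maximalIdeal B) B]
    (hfg : (maximalIdeal B).FG) {x : B} (hxm : x ∈ maximalIdeal B) {k : ℕ}
    (hk : maximalIdeal B ^ k ≤ Ideal.span {x}) : IsNoetherianRing B := by
  have hq : IsNoetherianRing (B ⧸ Ideal.span {x}) := by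
    refine IsNoetherianRing.of_prime fun P hP => ?_
    have h1 : P.comap (Ideal.Quotient.mk (Ideal.span {x})) = maximalIdeal B := by
      refine eq_maximalIdeal_of_pow_le_span hk inferInstance ?_
      rw [Ideal.mem_comap, Ideal.Quotient.eq_zero_iff_mem.2 (Ideal.mem_span_singleton_self x)]
      exact P.zero_mem
    rw [← Ideal.map_comap_of_surjective _ Ideal.Quotient.mk_surjective P, h1]
    exact hfg.map _
  refine IsNoetherianRing.of_prime fun P hP => ?_
  by_cases hx : x ∈ P
  · rw [eq_maximalIdeal_of_pow_le_span hk hP hx]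
    exact hfg
  classical
  -- By Cohen's criterion only primes matter. For `x ∉ P`, generators of the image of `P` in the
  -- noetherian ring `B / xB` are lifted to `P`.
  obtain ⟨J, hJP, hJ, hPJ⟩ : ∃ J : Ideal B, J ≤ P ∧ J.FG ∧ P ≤ J ⊔ Ideal.span {x} := by
    obtain ⟨s, hs⟩ := hq.noetherian (P.map (Ideal.Quotient.mk (Ideal.span {x})))
    have hs' : ∀ y ∈ s, ∃ z ∈ P, Ideal.Quotient.mk (Ideal.span {x}) z = y := fun y hy =>
      (Ideal.mem_map_iff_of_surjective _ Ideal.Quotient.mk_surjective).1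
        (hs ▸ Submodule.subset_span hy)
    choose! g hgP hg using hs'
    refine ⟨Ideal.span (s.image g), ?_, ⟨_, rfl⟩, ?_⟩
    · rw [Ideal.span_le]
      intro z hz
      obtain ⟨y, hy, rfl⟩ := Finset.mem_image.1 (Finset.mem_coe.1 hz)
      exact hgP y hy
    · intro z hz
      have h1 := Ideal.mem_map_of_mem (Ideal.Quotient.mk (Ideal.span {x})) hz
      have h2 : (Ideal.span (s.image g : Set B)).map (Ideal.Quotient.mk (Ideal.span {x})) =
          Ideal.span s := by
        rw [Ideal.map_span, Finset.coe_image, ← Set.image_comp]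
        congr 1
        refine (Set.image_congr fun y hy => ?_).trans (Set.image_id _)
        exact hg y hy
      rw [← hs, ← Ideal.span, ← h2] at h1
      have h3 : z ∈ ((Ideal.span (s.image g : Set B)).map (Ideal.Quotient.mk (Ideal.span {x}))).comap
        (Ideal.Quotient.mk (Ideal.span {x})) := h1
      rwa [Ideal.comap_map_of_surjective _ Ideal.Quotient.mk_surjective, ← RingHom.ker_eq_comap_bot,
        Ideal.mk_ker] at h3
  have hH := IsHausdorff.of_linearMap_injective (maximalIdeal B) (Submodule.subtype P)
    (Submodule.injective_subtype _)
  have hV : (Submodule.comap (Submodule.subtype P) J : Submodule B P).FG := by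
    refine Submodule.fg_of_fg_map_injective (Submodule.subtype P) (Submodule.injective_subtype _) ?_
    rw [Submodule.map_comap_subtype, inf_eq_right.2 hJP]
    exact hJ
  have htop := Submodule.eq_top_of_sup_smul_top_of_isPrecomplete (maximalIdeal B) _ hV ?_
  · have : J = P := le_antisymm hJP fun z hz => by
      have : (⟨z, hz⟩ : P) ∈ (Submodule.comap (Submodule.subtype P) J : Submodule B P) :=
        htop ▸ Submodule.mem_top
      exact this
    exact this ▸ hJ
  · rw [eq_top_iff]
    rintro ⟨z, hz⟩ -
    obtain ⟨a, ha, b, hb, hab⟩ := Submodule.mem_sup.1 (hPJ hz)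
    obtain ⟨c, rfl⟩ := Ideal.mem_span_singleton.1 hb
    -- Since `x ∉ P`, a multiple `x c` in `P` has `c ∈ P`; thus `P = J + xP`, and Nakayama's lemma
    -- over the complete ring applies.
    have hxc : x * c ∈ P := by
      have := P.sub_mem hz (hJP ha)
      rwa [← hab, add_sub_cancel_left] at this
    have hc : c ∈ P := (hP.mem_or_mem hxc).resolve_left hx
    refine Submodule.mem_sup.2 ⟨⟨a, hJP ha⟩, ha, x • ⟨c, hc⟩,
      Submodule.smul_mem_smul hxm Submodule.mem_top, Subtype.ext hab⟩

/-- Inverting `x` in a local ring whose maximal ideal is nilpotent modulo `x` gives a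
zero-dimensional ring. -/
theorem IsLocalization.krullDimLE_zero_of_pow_le_span [IsNoetherianRing B] {x : B}
    (hxm : x ∈ maximalIdeal B) {k : ℕ} (hk : maximalIdeal B ^ k ≤ Ideal.span {x})
    (M : Submonoid B) (hx : x ∈ M) (F : Type*) [CommRing F] [Algebra B F] [IsLocalization M F] :
    Ring.KrullDimLE 0 F := by
  refine Ring.KrullDimLE.mk₀ fun P hP => ?_
  obtain ⟨Q, hQ, hPQ⟩ := Ideal.exists_le_maximal P hP.ne_top
  have hu : IsUnit (algebraMap B F x) := IsLocalization.map_units F ⟨x, hx⟩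
  have hQx : x ∉ Q.comap (algebraMap B F) := fun h => hQ.ne_top (Ideal.eq_top_of_isUnit_mem _ h hu)
  -- By Krull's principal ideal theorem the maximal ideal has height at most one. Primes of `F`
  -- contract to primes avoiding `x`, hence strictly below it and of height zero, so no strict
  -- inclusion `P < Q` is left.
  have hmin : maximalIdeal B ∈ (Ideal.span {x}).minimalPrimes :=
    ⟨⟨inferInstance, (Ideal.span_singleton_le_iff_mem _).2 hxm⟩, fun p hp _ =>
      (eq_maximalIdeal_of_pow_le_span hk hp.1 ((Ideal.span_singleton_le_iff_mem _).1 hp.2)).ge⟩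
  have hht := Ideal.height_le_one_of_isPrincipal_of_mem_minimalPrimes _ _ hmin
  have hQp := hQ.isPrime
  have hlt : Q.comap (algebraMap B F) < maximalIdeal B :=
    lt_of_le_of_ne (le_maximalIdeal (Ideal.IsPrime.ne_top inferInstance)) fun h =>
      hQx (h ▸ hxm)
  have h1 := Ideal.height_add_one_le_of_lt_of_isPrime hlt
  have heq : P.comap (algebraMap B F) = Q.comap (algebraMap B F) := by
    by_contra hne
    have h2 := Ideal.height_add_one_le_of_lt_of_isPrime
      (lt_of_le_of_ne (Ideal.comap_mono (f := algebraMap B F) hPQ) hne)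
    have h3 : (Q.comap (algebraMap B F)).height = 0 := by
      have := h1.trans hht
      rw [← Order.lt_one_iff]
      by_contra hc
      have h5 : (1 : ℕ∞) + 1 ≤ 1 := (add_le_add_left (not_lt.1 hc) 1).trans this
      exact absurd h5 (by decide)
    rw [h3] at h2
    simp at h2
  have : P = Q := by
    rw [← IsLocalization.map_under M F P, ← IsLocalization.map_under M F Q]
    exact congrArg _ heq
  exact this ▸ hQ

end CompleteLocal

/-! ### Zero-dimensional regular rings and integrality after base change. -/

/-- A regular local ring of dimension zero is a field. -/
theorem IsRegularLocalRing.isField_of_krullDimLE_zero (A : Type*) [CommRing A]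
    [IsRegularLocalRing A] [Ring.KrullDimLE 0 A] : IsField A := by
  rw [IsLocalRing.isField_iff_maximalIdeal_eq,
    ← Submodule.spanFinrank_eq_zero_iff_eq_bot (IsNoetherian.noetherian _)]
  have h := IsRegularLocalRing.spanFinrank_maximalIdeal (R := A)
  have h0 : ringKrullDim A ≤ 0 := Order.KrullDimLE.krullDim_le
  rw [← h] at h0
  exact Nat.le_zero.1 (by exact_mod_cast h0)

/-- All localizations at maximal ideals are fields, so `F` is reduced; a reduced artinian ring is
semisimple. -/
theorem IsRegularRing.isSemisimpleRing_of_krullDimLE_zero (F : Type*) [CommRing F]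
    [IsRegularRing F] [Ring.KrullDimLE 0 F] : IsSemisimpleRing F := by
  have : IsArtinianRing F := isArtinianRing_iff_krullDimLE_zero.2 inferInstance
  have : IsReduced F := by
    refine isReduced_ofLocalizationMaximal F fun P hP => ?_
    have : Ring.KrullDimLE 0 (Localization.AtPrime P) :=
      .of_isLocalization P (Ideal.mem_minimalPrimes_of_krullDimLE_zero P) _
    let := (IsRegularLocalRing.isField_of_krullDimLE_zero (Localization.AtPrime P)).toField
    infer_instance
  exact IsArtinianRing.isSemisimpleRing_of_isReduced F

theorem IsIntegral.of_mem_range_map_val {R : Type*} [CommRing R]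
    (K : Type*) [Field K] [Algebra R K] (B : Type*) [CommRing B] [Algebra R B]
    (t : B ⊗[R] integralClosure R K) :
    IsIntegral B (Algebra.TensorProduct.map (AlgHom.id B B) (integralClosure R K).val t) := by
  induction t with
  | zero => simpa using isIntegral_zero
  | add a b ha hb => rw [map_add]; exact ha.add hb
  | tmul b s =>
    have : Algebra.TensorProduct.map (AlgHom.id B B) (integralClosure R K).val (b ⊗ₜ s) =
        b • ((1 : B) ⊗ₜ[R] (s : K)) := by
      simp [TensorProduct.smul_tmul']
    rw [this]
    refine IsIntegral.smul b ?_
    exact (IsIntegral.map (Algebra.TensorProduct.includeRight : K →ₐ[R] B ⊗[R] K) s.2).tower_top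

/-! ### Finiteness of the normalization by descent from the completion. -/

section AnalyticallyUnramified

open IsLocalRing

variable {R : Type*} [CommRing R] [IsDomain R] [IsNoetherianRing R] [IsLocalRing R]
  [Ring.KrullDimLE 1 R]

theorem IsLocalRing.exists_maximalIdeal_pow_le_span {x : R} (hx : x ≠ 0) :
    ∃ k, maximalIdeal R ^ k ≤ Ideal.span {x} := by
  have h := isFiniteLength_quotient_span_singleton R (mem_nonZeroDivisors_of_ne_zero hx)
  rw [isFiniteLength_iff_isNoetherian_isArtinian] at h
  have h2 : IsArtinianRing (R ⧸ Ideal.span {x}) :=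
    have := h.2
    isArtinian_of_tower R inferInstance
  exact exists_maximalIdeal_pow_le_of_isArtinianRing_quotient _

/-- Inverting `x` alone already gives `K`: some power of `x` is a multiple of any given denominator.
-/
theorem IsFractionRing.exists_pow_mul_eq_algebraMap {x : R} (hxm : x ∈ maximalIdeal R)
    {K : Type*} [Field K] [Algebra R K] [IsFractionRing R K] (q : K) :
    ∃ (k : ℕ) (r : R), algebraMap R K x ^ k * q = algebraMap R K r := by
  obtain ⟨a, c, hc, rfl⟩ := IsFractionRing.div_surjective (A := R) q
  have hc0 := nonZeroDivisors.ne_zero hc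
  obtain ⟨k, hk⟩ := exists_maximalIdeal_pow_le_span hc0
  obtain ⟨r, hr⟩ := Ideal.mem_span_singleton.1 (hk (Ideal.pow_mem_pow hxm k))
  have hc1 : algebraMap R K c ≠ 0 := by
    simpa using hc0
  refine ⟨k, r * a, ?_⟩
  rw [← map_pow, hr, map_mul, map_mul]
  field_simp

variable (K : Type*) [Field K] [Algebra R K] [IsFractionRing R K]
  (B : Type*) [CommRing B] [Algebra R B] [IsLocalRing B]

/-- If `B ⊗ K` is semisimple, then the base change to `B` of the normalization is separated. -/
theorem IsHausdorff.tensorProduct_integralClosure [Module.Flat R B]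
    (hB : maximalIdeal B = (maximalIdeal R).map (algebraMap R B))
    [IsSemisimpleRing (B ⊗[R] K)] {x : R} (hxm : x ∈ maximalIdeal R) (hx : x ≠ 0) :
    IsHausdorff (maximalIdeal B) (B ⊗[R] integralClosure R K) := by
  let ι := Algebra.TensorProduct.map (AlgHom.id B B) (integralClosure R K).val
  have hι : Function.Injective ι :=
    Module.Flat.lTensor_preserves_injective_linearMap (M := B) (integralClosure R K).val.toLinearMap
      Subtype.val_injective
  have hx1 : algebraMap R K x ≠ 0 := by simpa using hx
  let w : B ⊗[R] K := 1 ⊗ₜ (algebraMap R K x)⁻¹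
  have hw : algebraMap B (B ⊗[R] K) (algebraMap R B x) * w = 1 := by
    simp only [w, Algebra.TensorProduct.algebraMap_apply, Algebra.algebraMap_self_apply,
      Algebra.TensorProduct.tmul_mul_tmul, mul_one, one_mul]
    rw [Algebra.algebraMap_eq_smul_one, TensorProduct.smul_tmul, Algebra.smul_def,
      mul_inv_cancel₀ hx1, Algebra.TensorProduct.one_def]
  have hT : ∀ f : B ⊗[R] K, ∃ (k : ℕ) (t : _), f = w ^ k * ι t := by
    intro f
    induction f with
    | zero => exact ⟨0, 0, by simp⟩
    | add f g hf hg =>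
      obtain ⟨k, t, rfl⟩ := hf
      obtain ⟨l, s, rfl⟩ := hg
      refine ⟨k + l, algebraMap R B x ^ l • t + algebraMap R B x ^ k • s, ?_⟩
      have h1 : ∀ j, algebraMap B (B ⊗[R] K) (algebraMap R B x) ^ j * w ^ j = 1 := fun j => by
        rw [← mul_pow, hw, one_pow]
      rw [map_add, map_smul, map_smul, Algebra.smul_def, Algebra.smul_def, map_pow, map_pow]
      linear_combination (-w ^ k * ι t) * h1 l - w ^ l * ι s * h1 k
    | tmul b q =>
      obtain ⟨k, r, hr⟩ := IsFractionRing.exists_pow_mul_eq_algebraMap hxm q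
      refine ⟨k, b ⊗ₜ algebraMap R _ r, ?_⟩
      simp only [w, ι, Algebra.TensorProduct.tmul_pow, one_pow, Algebra.TensorProduct.map_tmul,
        AlgHom.id_apply, Algebra.TensorProduct.tmul_mul_tmul, one_mul, AlgHom.commutes]
      rw [← hr, ← mul_assoc, ← mul_pow, inv_mul_cancel₀ hx1, one_pow, one_mul]
  -- The elements of `B ⊗ S` divisible there by all powers of `x`. They form an ideal of the whole
  -- of `B ⊗ K`, since by `hT` every scalar becomes an element of `B ⊗ S` after multiplication by a
  -- power of `x`.
  let N : Ideal (B ⊗[R] K) :=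
    { carrier := {f | ∀ n : ℕ, w ^ n * f ∈ ι.range}
      zero_mem' := fun n => by rw [mul_zero]; exact zero_mem _
      add_mem' := fun {a b} ha hb n => by rw [mul_add]; exact add_mem (ha n) (hb n)
      smul_mem' := fun c f hf n => by
        obtain ⟨k, t, rfl⟩ := hT c
        have : w ^ n * (w ^ k * ι t) • f = ι t * (w ^ (n + k) * f) := by
          rw [smul_eq_mul]; ring
        rw [this]
        exact mul_mem ⟨t, rfl⟩ (hf _) }
  have hN : N = ⊥ := by
    obtain ⟨e, he, hNe⟩ := IsSemisimpleRing.ideal_eq_span_idempotent N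
    have heN : e ∈ N := hNe ▸ Ideal.mem_span_singleton_self e
    obtain ⟨t, ht⟩ := heN 1
    have hint : IsIntegral B (e * w) := by
      have h := IsIntegral.of_mem_range_map_val K B t
      have h2 : ι t = e * w := by rw [mul_comm, ← pow_one w]; exact ht
      exact h2 ▸ h
    have hjac : algebraMap R B x ∈ Ideal.jacobson (⊥ : Ideal B) := by
      rw [IsLocalRing.jacobson_eq_maximalIdeal ⊥ bot_ne_top, hB]
      exact Ideal.mem_map_of_mem _ hxm
    have he0 : e = 0 := IsIdempotentElem.eq_zero_of_isIntegral_div hjac hw he hint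
    rw [hNe, he0]
    simp
  refine ⟨fun y hy => hι ?_⟩
  -- The `k n`-th power of the maximal ideal lies in `(x ^ n)`, so an element in all powers of that
  -- ideal times the module is divisible by every `x ^ n` and lies in `N`.
  rw [map_zero, ← Submodule.mem_bot (R := B ⊗[R] K), ← hN]
  intro n
  obtain ⟨k, hk⟩ := exists_maximalIdeal_pow_le_span hx
  have hk' : maximalIdeal B ^ (k * n) ≤ Ideal.span {algebraMap R B x ^ n} := by
    rw [pow_mul, hB, ← Ideal.map_pow, ← Ideal.span_singleton_pow]
    refine Ideal.pow_right_mono ((Ideal.map_mono hk).trans ?_) n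
    rw [Ideal.map_span, Set.image_singleton]
  have h := hy (k * n)
  rw [SModEq.zero] at h
  have h := Submodule.smul_mono hk' le_rfl h
  rw [Submodule.ideal_span_singleton_smul] at h
  obtain ⟨t, -, rfl⟩ := h
  refine ⟨t, ?_⟩
  change ι t = w ^ n * ι (algebraMap R B x ^ n • t)
  rw [map_smul, Algebra.smul_def, map_pow, ← mul_assoc, mul_comm (w ^ n), ← mul_pow, hw, one_pow,
    one_mul]

/-- The normalization of a one-dimensional noetherian local domain is finite as soon as the domain
has a faithfully flat complete local extension `B` with the same maximal ideal such that
`B ⊗ K` is semisimple. -/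
theorem Module.Finite.integralClosure_of_isSemisimpleRing [Module.FaithfullyFlat R B]
    [IsAdicComplete (maximalIdeal B) B]
    (hB : maximalIdeal B = (maximalIdeal R).map (algebraMap R B))
    [IsSemisimpleRing (B ⊗[R] K)] {x : R} (hxm : x ∈ maximalIdeal R) (hx : x ≠ 0) :
    Module.Finite R (integralClosure R K) := by
  have := IsHausdorff.tensorProduct_integralClosure K B hB hxm hx
  have hfin : Module.Finite R (integralClosure R K ⧸
      LinearMap.range (LinearMap.lsmul R (integralClosure R K) x)) :=
    Submodule.finite_quotient_range_lsmul (K := K) hx (Subalgebra.toSubmodule (integralClosure R K))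
  obtain ⟨V, hV, hVx⟩ : ∃ V : Submodule R (integralClosure R K), V.FG ∧
      V ⊔ LinearMap.range (LinearMap.lsmul R (integralClosure R K) x) = ⊤ := by
    obtain ⟨k, s, hs⟩ := Submodule.fg_iff_exists_fin_generating_family.1 hfin.fg_top
    choose t ht using fun i => Submodule.mkQ_surjective _ (s i)
    refine ⟨Submodule.span R (Set.range t), Submodule.fg_span (Set.finite_range t), ?_⟩
    rw [sup_comm, ← Submodule.map_mkQ_eq_top, Submodule.map_span, ← Set.range_comp]
    rw [show ⇑(Submodule.mkQ _) ∘ t = s from funext ht, hs]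
  -- `V` generates `S` modulo `x`, so its base change is everything modulo the maximal ideal of `B`;
  -- separatedness makes it everything, and faithful flatness then gives `V = S`.
  have htop := Submodule.eq_top_of_sup_smul_top_of_isPrecomplete (maximalIdeal B)
    (V.baseChange B) ?_ ?_
  · have hs : Function.Surjective (V.subtype.lTensor B) :=
      fun y => (htop ▸ Submodule.mem_top : y ∈ V.baseChange B)
    rw [Module.FaithfullyFlat.lTensor_surjective_iff_surjective, ← LinearMap.range_eq_top,
      Submodule.range_subtype] at hs
    exact ⟨hs ▸ hV⟩
  · obtain ⟨s, rfl⟩ := hV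
    rw [Submodule.baseChange_span]
    exact Submodule.fg_span (s.finite_toSet.image _)
  · rw [eq_top_iff]
    rintro y -
    induction y with
    | zero => exact zero_mem _
    | add y z hy hz => exact add_mem hy hz
    | tmul b s =>
      obtain ⟨v, hv, _, ⟨z, rfl⟩, rfl⟩ := Submodule.mem_sup.1 (hVx ▸ Submodule.mem_top : s ∈ _)
      rw [TensorProduct.tmul_add]
      refine add_mem (Submodule.mem_sup_left (Submodule.tmul_mem_baseChange_of_mem b hv))
        (Submodule.mem_sup_right ?_)
      have : b ⊗ₜ[R] (LinearMap.lsmul R (integralClosure R K) x z) = algebraMap R B x • (b ⊗ₜ z) := by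
        rw [LinearMap.lsmul_apply, TensorProduct.tmul_smul, algebraMap_smul]
      rw [this]
      exact Submodule.smul_mem_smul (hB ▸ Ideal.mem_map_of_mem _ hxm) Submodule.mem_top

end AnalyticallyUnramified

open IsLocalRing in
theorem Module.Finite.integralClosure_of_isRegularAlgebra (A : Type u) [CommRing A] [IsDomain A]
    [IsNoetherianRing A] [IsLocalRing A] (hdim : ringKrullDim A = 1)
    (h : IsRegularAlgebra A (AdicCompletion (maximalIdeal A) A))
    (K : Type v) [Field K] [Algebra A K] [IsFractionRing A K] :
    Module.Finite A (integralClosure A K) := by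
  have hK : Ring.KrullDimLE 1 A := (Order.krullDimLE_iff _ _).2 hdim.le
  obtain ⟨x, hxm, hx⟩ : ∃ x ∈ maximalIdeal A, x ≠ 0 := by
    refine Submodule.exists_mem_ne_zero_of_ne_bot fun hbot => ?_
    rw [← isField_iff_maximalIdeal_eq] at hbot
    rw [ringKrullDim_eq_zero_of_isField hbot] at hdim
    exact zero_ne_one hdim
  let B := AdicCompletion (maximalIdeal A) A
  let k := (⊥ : Ideal A).ResidueField
  have hB : maximalIdeal B = (maximalIdeal A).map (algebraMap A B) :=
    AdicCompletion.maximalIdeal_eq_map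
  have : Module.FaithfullyFlat A B := Module.FaithfullyFlat.of_flat_of_isLocalHom
  obtain ⟨j, hj⟩ := exists_maximalIdeal_pow_le_span hx
  have hj' : maximalIdeal B ^ j ≤ Ideal.span {algebraMap A B x} := by
    rw [hB, ← Ideal.map_pow, ← Set.image_singleton, ← Ideal.map_span]
    exact Ideal.map_mono hj
  have hxB : algebraMap A B x ∈ maximalIdeal B := hB ▸ Ideal.mem_map_of_mem _ hxm
  have : IsNoetherianRing B := IsLocalRing.isNoetherianRing_of_pow_le_span
    (hB ▸ ((maximalIdeal A).fg_of_isNoetherianRing.map _)) hxB hj'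
  -- Of geometric regularity of the generic formal fibre, only the trivial extension `L = k` is
  -- used.
  have hreg : IsRegularRing (k ⊗[k] (k ⊗[A] B)) := h.fiber ⊥ k
  have hreg : IsRegularRing (B ⊗[A] k) := IsRegularRing.of_ringEquiv (R := k ⊗[k] (k ⊗[A] B))
    ((Algebra.TensorProduct.lid k (k ⊗[A] B)).toRingEquiv.trans
      (Algebra.TensorProduct.comm A k B).toRingEquiv)
  have : Ring.KrullDimLE 0 (B ⊗[A] k) := IsLocalization.krullDimLE_zero_of_pow_le_span hxB hj'
    (Algebra.algebraMapSubmonoid B (nonZeroDivisors A)) ⟨x, mem_nonZeroDivisors_of_ne_zero hx, rfl⟩ _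
  have : IsSemisimpleRing (B ⊗[A] k) := IsRegularRing.isSemisimpleRing_of_krullDimLE_zero _
  have : Module.Finite A (integralClosure A k) :=
    Module.Finite.integralClosure_of_isSemisimpleRing k B hB hxm hx
  exact Module.Finite.equiv
    ((IsLocalization.algEquiv (nonZeroDivisors A) k K).mapIntegralClosure).toLinearEquiv

/-- The formal fibre condition concerns `R` localized at its maximal ideal, which is isomorphic to
`R`; finiteness is carried across this isomorphism. -/
theorem Module.Finite.normalization_of_isExcellentRing (R : Type u) [CommRing R] [IsDomain R]
    [IsLocalRing R] [IsExcellentRing R] (hdim : ringKrullDim R = 1) :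
    Module.Finite R (Normalization R) := by
  let A := Localization.AtPrime (IsLocalRing.maximalIdeal R)
  let e : R ≃ₐ[R] A := IsLocalization.atUnits R (IsLocalRing.maximalIdeal R).primeCompl
    fun x hx => by simpa using! hx
  let K := FractionRing R
  have hA : ringKrullDim A = 1 := (ringKrullDim_eq_of_ringEquiv e.toRingEquiv).symm.trans hdim
  let _ : Algebra A K := ((algebraMap R K).comp e.symm.toRingEquiv.toRingHom).toAlgebra
  have : IsScalarTower R A K := IsScalarTower.of_algebraMap_eq fun r => by
    change _ = algebraMap R K (e.symm (algebraMap R A r))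
    rw [AlgEquiv.commutes]
    rfl
  have : IsFractionRing A K := by
    have h := IsLocalization.isLocalization_of_base_ringEquiv (nonZeroDivisors R) K e.toRingEquiv
    rwa [MulEquivClass.map_nonZeroDivisors] at h
  have : Module.Finite A (integralClosure A K) :=
    Module.Finite.integralClosure_of_isRegularAlgebra A hA
      (IsExcellentRing.regular_formal_fibers (IsLocalRing.maximalIdeal R)) K
  have : Module.Finite R A := Module.Finite.equiv e.toLinearEquiv
  have : Module.Finite R (integralClosure A K) := Module.Finite.trans A _
  exact Module.Finite.of_surjective
    (LinearMap.codRestrict (Subalgebra.toSubmodule (Normalization R))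
      ((integralClosure A K).val.restrictScalars R).toLinearMap fun z => isIntegral_trans _ z.2)
    fun z => ⟨⟨z, z.2.tower_top⟩, rfl⟩

/-! ### Freeness over the normalization, and the conductor. -/

/-- A nontrivial finite free module splits off a copy of the ring, linearly over any base. -/
theorem Module.Free.exists_linearEquiv_prod (R : Type*) [CommRing R] (C : Type*) [CommRing C]
    [Algebra R C] (M : Type*) [AddCommGroup M] [Module R M] [Module C M] [IsScalarTower R C M]
    [Module.Free C M] [Module.Finite C M] [Nontrivial M] [Nontrivial C] :
    ∃ n : ℕ, Nonempty (M ≃ₗ[R] C × (Fin n → C)) := by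
  let b := Module.finBasis C M
  obtain ⟨n, hn⟩ : ∃ n, Module.finrank C M = n + 1 :=
    Nat.exists_eq_succ_of_ne_zero (Module.finrank_pos_iff_of_free C M |>.2 inferInstance).ne'
  let e := (b.reindex (finCongr hn)).equivFun ≪≫ₗ (Fin.consLinearEquiv C (fun _ : Fin (n + 1) => C)).symm
  exact ⟨n, ⟨e.restrictScalars R⟩⟩

section Normalization

variable (R : Type u) [CommRing R] [IsDomain R]

/-- Writing `s = a / b`, take `t = b`. This reduces torsionfreeness over `S` to torsionfreeness over
`R`. -/
theorem Normalization.exists_mul_eq_algebraMap (s : Normalization R) (hs : s ≠ 0) :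
    ∃ (t : Normalization R) (a : R), a ≠ 0 ∧ s * t = algebraMap R _ a := by
  obtain ⟨a, b, hb, hab⟩ := IsFractionRing.div_surjective (A := R) (s : FractionRing R)
  have hb0 : algebraMap R (FractionRing R) b ≠ 0 := by
    simpa using nonZeroDivisors.ne_zero hb
  have h : (s : FractionRing R) * algebraMap R _ b = algebraMap R _ a := by
    rw [← hab, div_mul_cancel₀ _ hb0]
  refine ⟨algebraMap R _ b, a, ?_, Subtype.ext h⟩
  rintro rfl
  rw [map_zero, mul_eq_zero] at h
  exact hs (Subtype.ext (h.resolve_right hb0))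

/-- The normalization is a Dedekind domain, and finitely many primes lie over the maximal ideal of
`R`; a Dedekind domain with finitely many maximal ideals is principal. -/
theorem Normalization.isPrincipalIdealRing [IsNoetherianRing R] [IsLocalRing R]
    [Ring.KrullDimLE 1 R] [Module.Finite R (Normalization R)] :
    IsPrincipalIdealRing (Normalization R) := by
  have hdim : Ring.DimensionLEOne R :=
    ⟨fun {p} hp hpp => Ring.krullDimLE_one_iff_of_noZeroDivisors.1 inferInstance p hp hpp⟩
  have : Ring.DimensionLEOne (Normalization R) := inferInstance
  have : IsNoetherianRing (Normalization R) := .of_finite R _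
  have : IsFractionRing (Normalization R) (FractionRing R) :=
    integralClosure.isFractionRing_of_finite_extension (FractionRing R) (FractionRing R)
  have : IsIntegrallyClosed (Normalization R) :=
    (isIntegrallyClosed_iff_isIntegrallyClosedIn (FractionRing R)).2 inferInstance
  have : IsDedekindDomain (Normalization R) := {}
  refine IsPrincipalIdealRing.of_finite_maximals
    ((Algebra.QuasiFinite.finite_primesOver (R := R) (S := Normalization R)
      (IsLocalRing.maximalIdeal R)).subset fun I hI => ?_)
  have hI' : I.IsMaximal := hI
  refine ⟨hI'.isPrime, ⟨?_⟩⟩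
  exact (IsLocalRing.eq_maximalIdeal (Ideal.isMaximal_comap_of_isIntegral_of_isMaximal I)).symm

/-- The homomorphisms from the normalization into a nonzero torsionfree module have the
normalization as a direct summand. -/
theorem Normalization.exists_linearMap_equiv_prod [IsNoetherianRing R] [IsLocalRing R]
    [Ring.KrullDimLE 1 R] [Module.Finite R (Normalization R)] (X : Type*) [AddCommGroup X]
    [Module R X] [Module.Finite R X] [Nontrivial X] [Module.IsTorsionFree R X]
    [Module.Finite R (Normalization R →ₗ[R] X)] :
    ∃ n : ℕ, Nonempty ((Normalization R →ₗ[R] X) ≃ₗ[R]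
      Normalization R × (Fin n → Normalization R)) := by
  have := Normalization.isPrincipalIdealRing R
  -- `X` carries no action of `S`, so `S` acts on the source of a homomorphism.
  let _ : Module (Normalization R) (Normalization R →ₗ[R] X) :=
    { smul := fun s f => f ∘ₗ LinearMap.mulLeft R s
      one_smul := fun f => LinearMap.ext fun t => congrArg f (one_mul t)
      mul_smul := fun s t f => LinearMap.ext fun r => congrArg f (by
        change s * t * r = t * (s * r)
        ring)
      smul_zero := fun s => rfl
      smul_add := fun s f g => rfl
      add_smul := fun s t f => LinearMap.ext fun r => by
        change f ((s + t) * r) = f (s * r) + f (t * r)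
        rw [add_mul, map_add]
      zero_smul := fun f => LinearMap.ext fun r => by
        change f (0 * r) = 0
        rw [zero_mul, map_zero] }
  have hsmul : ∀ (s t : Normalization R) (f : Normalization R →ₗ[R] X), (s • f) t = f (s * t) :=
    fun s t f => rfl
  have : IsScalarTower R (Normalization R) (Normalization R →ₗ[R] X) :=
    .of_algebraMap_smul fun r f => LinearMap.ext fun t => by
      rw [hsmul, LinearMap.smul_apply, ← Algebra.smul_def, map_smul]
  have : Module.Finite (Normalization R) (Normalization R →ₗ[R] X) :=
    Module.Finite.of_restrictScalars_finite R _ _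
  have : Module.IsTorsionFree (Normalization R) (Normalization R →ₗ[R] X) := by
    refine .of_smul_eq_zero fun s f hf => or_iff_not_imp_left.2 fun hs => LinearMap.ext fun u => ?_
    obtain ⟨t, a, ha, hst⟩ := Normalization.exists_mul_eq_algebraMap R s hs
    have h1 : f (s * (t * u)) = 0 := by rw [← hsmul, hf]; rfl
    rw [← mul_assoc, hst, ← Algebra.smul_def, map_smul] at h1
    exact (smul_eq_zero.1 h1).resolve_left ha
  -- Compose an embedding of `S` into `R` with `r ↦ r • x` for some `x ≠ 0`.
  have : Nontrivial (Normalization R →ₗ[R] X) := by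
    obtain ⟨φ, hφ⟩ := (Subalgebra.toSubmodule (Normalization R)).exists_injective_of_fg
      (Module.Finite.iff_fg.1 ‹_›)
    obtain ⟨x, hx⟩ := exists_ne (0 : X)
    let φ' : Normalization R →ₗ[R] R := φ
    have hφ' : Function.Injective φ' := hφ
    refine ⟨(LinearMap.toSpanSingleton R X x) ∘ₗ φ', 0, fun h => ?_⟩
    have h1 : φ' 1 • x = 0 := LinearMap.congr_fun h 1
    have h2 : φ' 1 = φ' 0 := ((smul_eq_zero.1 h1).resolve_right hx).trans (map_zero φ').symm
    exact one_ne_zero (hφ' h2)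
  exact Module.Free.exists_linearEquiv_prod R (Normalization R) _

theorem mem_conductorIdeal_iff (r : R) :
    r ∈ conductorIdeal R ↔ ∀ s : Normalization R, ∃ a : R,
      algebraMap R (Normalization R) a = algebraMap R _ r * s := by
  rw [conductorIdeal, Submodule.mem_comap, Submodule.mem_div_iff_forall_mul_mem]
  constructor
  · intro h s
    obtain ⟨a, ha⟩ := Submodule.mem_one.1 (h s s.2)
    exact ⟨a, Subtype.ext ha⟩
  · intro h y hy
    obtain ⟨a, ha⟩ := h ⟨y, hy⟩
    exact Submodule.mem_one.2 ⟨a, congrArg Subtype.val ha⟩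

/-- An `R`-linear injection `φ : S → R` is multiplication by `φ 1` inside `Q`, so `φ 1` carries `S`
into `R`. -/
theorem exists_mem_conductorIdeal_ne_zero [Module.Finite R (Normalization R)] :
    ∃ r ∈ conductorIdeal R, r ≠ 0 := by
  obtain ⟨φ, hφ⟩ := (Subalgebra.toSubmodule (Normalization R)).exists_injective_of_fg
    (Module.Finite.iff_fg.1 ‹_›)
  let φ' : Normalization R →ₗ[R] R := φ
  have hφ' : Function.Injective φ' := hφ
  refine ⟨φ' 1, (mem_conductorIdeal_iff R _).2 fun s => ⟨φ' s, ?_⟩, fun h =>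
    one_ne_zero (hφ' (h.trans (map_zero φ').symm))⟩
  obtain ⟨a, b, hb, hab⟩ := IsFractionRing.div_surjective (A := R) (s : FractionRing R)
  have hb0 : algebraMap R (FractionRing R) b ≠ 0 := by
    simpa using nonZeroDivisors.ne_zero hb
  have hs : b • s = a • (1 : Normalization R) := by
    apply Subtype.ext
    change b • (s : FractionRing R) = a • (1 : FractionRing R)
    rw [← hab, Algebra.smul_def, Algebra.smul_def, mul_div_cancel₀ _ hb0, mul_one]
  have h1 := congrArg φ' hs
  rw [map_smul, map_smul, smul_eq_mul, smul_eq_mul] at h1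
  apply smul_right_injective (Normalization R) (nonZeroDivisors.ne_zero hb)
  change b • _ = b • _
  rw [← mul_smul_comm, hs, Algebra.smul_def, ← map_mul, h1, mul_smul_comm, mul_one,
    Algebra.smul_def, map_mul]

/-- The conductor is isomorphic to the normalization. -/
theorem nonempty_conductorIdeal_linearEquiv [IsNoetherianRing R] [IsLocalRing R]
    [Ring.KrullDimLE 1 R] [Module.Finite R (Normalization R)] :
    Nonempty (Normalization R ≃ₗ[R] conductorIdeal R) := by
  have := Normalization.isPrincipalIdealRing R
  -- The conductor is also an ideal of `S`; being nonzero and principal, it is isomorphic to `S`.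
  let I : Ideal (Normalization R) :=
    { carrier := {s | ∃ r ∈ conductorIdeal R, algebraMap R _ r = s}
      zero_mem' := ⟨0, zero_mem _, map_zero _⟩
      add_mem' := by
        rintro _ _ ⟨a, ha, rfl⟩ ⟨b, hb, rfl⟩
        exact ⟨a + b, add_mem ha hb, map_add _ _ _⟩
      smul_mem' := by
        rintro s _ ⟨a, ha, rfl⟩
        obtain ⟨b, hb⟩ := (mem_conductorIdeal_iff R a).1 ha s
        refine ⟨b, (mem_conductorIdeal_iff R b).2 fun t => ?_, by rw [hb, smul_eq_mul, mul_comm]⟩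
        obtain ⟨c, hc⟩ := (mem_conductorIdeal_iff R a).1 ha (s * t)
        exact ⟨c, by rw [hc, hb, mul_assoc]⟩ }
  obtain ⟨r, hr, hr0⟩ := exists_mem_conductorIdeal_ne_zero R
  have hinj : Function.Injective (algebraMap R (Normalization R)) :=
    FaithfulSMul.algebraMap_injective _ _
  let f : conductorIdeal R →ₗ[R] I.restrictScalars R :=
    ((Algebra.linearMap R (Normalization R)) ∘ₗ (conductorIdeal R).subtype).codRestrict _
      fun x => ⟨x, x.2, rfl⟩
  have hf : Function.Bijective f := by
    constructor
    · intro a b hab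
      exact Subtype.ext (hinj (congrArg Subtype.val hab))
    · rintro ⟨_, a, ha, rfl⟩
      exact ⟨⟨a, ha⟩, rfl⟩
  obtain ⟨g, hg⟩ := IsPrincipalIdealRing.principal I
  have hg0 : g ≠ 0 := by
    rintro rfl
    have h : algebraMap R (Normalization R) r ∈ I := ⟨r, hr, rfl⟩
    rw [hg, Submodule.span_zero_singleton, Submodule.mem_bot] at h
    exact hr0 (hinj (h.trans (map_zero _).symm))
  let e : Normalization R ≃ₗ[Normalization R] I :=
    LinearEquiv.toSpanNonzeroSingleton (Normalization R) (Normalization R) g hg0 ≪≫ₗ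
      LinearEquiv.ofEq _ _ hg.symm
  let e' : Normalization R ≃ₗ[R] I.restrictScalars R := e.restrictScalars R
  exact ⟨e' ≪≫ₗ (LinearEquiv.ofBijective f hf).symm⟩

end Normalization

/-! ### Closure properties of IKE-closed subcategories, and the four examples. -/

namespace ModSubcategory

variable {R : Type u} [CommRing R]

theorem prop_of_linearEquiv {𝒳 : ObjectProperty (FGModuleCat.{u} R)}
    (h𝒳 : 𝒳.IsClosedUnderIsomorphisms) {X Y : FGModuleCat.{u} R} (e : X ≃ₗ[R] Y) (hX : 𝒳 X) :
    𝒳 Y :=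
  𝒳.prop_of_iso (LinearEquiv.toFGModuleCatIso e) hX

theorem isClosedUnderIsomorphisms_of_linearEquiv {𝒳 : ObjectProperty (FGModuleCat.{u} R)}
    (h : ∀ (X Y : FGModuleCat.{u} R) (_ : X ≃ₗ[R] Y), 𝒳 X → 𝒳 Y) :
    𝒳.IsClosedUnderIsomorphisms :=
  ⟨fun {X Y} e hX => h X Y (FGModuleCat.isoToLinearEquiv e) hX⟩

section IKE

variable [IsNoetherianRing R]

namespace IsIKEClosed

variable {𝒳 : ObjectProperty (FGModuleCat.{u} R)} (h : IsIKEClosed 𝒳)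

include h

theorem of_linearEquiv {X Y : FGModuleCat.{u} R} (e : X ≃ₗ[R] Y) (hX : 𝒳 X) : 𝒳 Y :=
  prop_of_linearEquiv h.iso e hX

theorem of_subsingleton (Y : FGModuleCat.{u} R) [Subsingleton Y] : 𝒳 Y := by
  obtain ⟨X, hX⟩ := h.nonempty
  have h1 := h.kernels X X LinearMap.id hX hX
  have : Subsingleton (LinearMap.ker (LinearMap.id : X →ₗ[R] X)) := by
    rw [LinearMap.ker_id]
    infer_instance
  exact h.of_linearEquiv (X := FGModuleCat.of R (LinearMap.ker (LinearMap.id : X →ₗ[R] X)))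
    (0 : LinearMap.ker (LinearMap.id : X →ₗ[R] X) ≃ₗ[R] Y) h1

theorem prod {X Y : FGModuleCat.{u} R} (hX : 𝒳 X) (hY : 𝒳 Y) : 𝒳 (FGModuleCat.of R (X × Y)) :=
  h.extensions X (FGModuleCat.of R (X × Y)) Y (LinearMap.inl R X Y) (LinearMap.snd R X Y)
    LinearMap.inl_injective Function.Exact.inl_snd LinearMap.snd_surjective hX hY

theorem pi_fin {X : FGModuleCat.{u} R} (hX : 𝒳 X) (n : ℕ) :
    𝒳 (FGModuleCat.of R (Fin n → X)) := by
  induction n with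
  | zero =>
    have : Subsingleton (FGModuleCat.of R (Fin 0 → X)) :=
      inferInstanceAs (Subsingleton (Fin 0 → X))
    exact h.of_subsingleton _
  | succ n ih => exact h.of_linearEquiv (Fin.consLinearEquiv R (fun _ : Fin (n + 1) => X)) (h.prod hX ih)

/-- A direct summand of `X` is the image of an idempotent endomorphism of `X`. -/
theorem closedUnderSummands : ClosedUnderSummands 𝒳 := by
  intro X Y Z e hX
  let p : X →ₗ[R] X := (e.symm.toLinearMap ∘ₗ LinearMap.inl R Y Z) ∘ₗ
    (LinearMap.fst R Y Z ∘ₗ e.toLinearMap)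
  have hinj : Function.Injective (e.symm.toLinearMap ∘ₗ LinearMap.inl R Y Z) :=
    e.symm.injective.comp LinearMap.inl_injective
  have hp : LinearMap.range p = LinearMap.range (e.symm.toLinearMap ∘ₗ LinearMap.inl R Y Z) :=
    LinearMap.range_comp_of_range_eq_top _ (LinearMap.range_eq_top.2
      (Prod.fst_surjective.comp e.surjective))
  have h1 := h.images X X p hX hX
  exact h.of_linearEquiv (X := FGModuleCat.of R (LinearMap.range p))
    (LinearEquiv.ofEq _ _ hp ≪≫ₗ (LinearEquiv.ofInjective _ hinj).symm) h1

/-- A finite presentation of `M` exhibits `Hom(M, X)` as the kernel of a map between finite powers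
of `X`. -/
theorem homIdeal : HomIdeal 𝒳 := by
  intro M X hX
  obtain ⟨n, f, hf⟩ := Module.Finite.exists_fin' R M
  obtain ⟨m, g, hg⟩ := Module.Finite.exists_fin' R (LinearMap.ker f)
  let g' : (Fin m → R) →ₗ[R] (Fin n → R) := (LinearMap.ker f).subtype ∘ₗ g
  have hg' : Function.Exact g' f := by
    rw [LinearMap.exact_iff, LinearMap.range_comp_of_range_eq_top _ (LinearMap.range_eq_top.2 hg),
      Submodule.range_subtype]
  have hfree : ∀ k : ℕ, 𝒳 (FGModuleCat.of R ((Fin k → R) →ₗ[R] X)) := fun k =>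
    h.of_linearEquiv (X := FGModuleCat.of R (Fin k → X)) ((Pi.basisFun R (Fin k)).constr R)
      (h.pi_fin hX k)
  have h1 := h.kernels _ _ (LinearMap.lcomp R X g') (hfree n) (hfree m)
  have hex := LinearMap.exact_lcomp_of_exact_of_surjective X hg' hf
  have hinj : Function.Injective (LinearMap.lcomp R X f) := fun a b hab =>
    LinearMap.ext fun y => by
      obtain ⟨z, rfl⟩ := hf y
      exact LinearMap.congr_fun hab z
  rw [LinearMap.exact_iff] at hex
  exact h.of_linearEquiv (X := FGModuleCat.of R (LinearMap.ker (LinearMap.lcomp R X g')))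
    (LinearEquiv.ofEq _ _ hex ≪≫ₗ (LinearEquiv.ofInjective _ hinj).symm) h1

theorem ext_le {M N : FGModuleCat.{u} R} (hM : 𝒳 M) (hN : ext M N) : 𝒳 N :=
  hN 𝒳 h.iso hM h.closedUnderSummands h.extensions

end IsIKEClosed

/-- Subcategories closed under subobjects and extensions are IKE-closed. -/
theorem IsTorsionfree.isIKEClosed {𝒳 : ObjectProperty (FGModuleCat.{u} R)} (h : IsTorsionfree 𝒳) :
    IsIKEClosed 𝒳 where
  nonempty := h.nonempty
  iso := h.iso
  images _ Y f _ hY := h.subobjects Y (LinearMap.range f) hY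
  kernels X _ f hX _ := h.subobjects X (LinearMap.ker f) hX
  extensions := h.extensions

theorem isTorsionfree_zero : IsTorsionfree (zero R) where
  nonempty := ⟨FGModuleCat.of R PUnit, inferInstanceAs (Subsingleton PUnit)⟩
  iso := isClosedUnderIsomorphisms_of_linearEquiv fun _ _ e (h : Subsingleton _) =>
    e.symm.injective.subsingleton
  subobjects X Y (h : Subsingleton X) := inferInstanceAs (Subsingleton Y)
  extensions L M N f g hf hfg hg (hL : Subsingleton L) (hN : Subsingleton N) := by
    refine ⟨fun a b => ?_⟩
    have h0 : ∀ c : M, c = 0 := fun c => by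
      obtain ⟨l, rfl⟩ := (hfg c).1 (Subsingleton.elim _ _)
      rw [Subsingleton.elim l 0, map_zero]
    rw [h0 a, h0 b]

theorem isTorsionfree_fl : IsTorsionfree (fl R) where
  nonempty := ⟨FGModuleCat.of R PUnit, IsFiniteLength.of_subsingleton⟩
  iso := isClosedUnderIsomorphisms_of_linearEquiv fun _ _ e h => e.isFiniteLength h
  subobjects _ Y h := IsFiniteLength.of_injective h Y.injective_subtype
  extensions L M N f g hf hfg hg hL hN := by
    have h1 := Module.length_eq_add_of_exact f g hf hg hfg
    change IsFiniteLength R M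
    rw [← Module.length_ne_top_iff, h1]
    exact WithTop.add_ne_top.2 ⟨Module.length_ne_top_iff.2 hL, Module.length_ne_top_iff.2 hN⟩

theorem isTorsionfree_tf [IsDomain R] : IsTorsionfree (tf R) where
  nonempty := ⟨FGModuleCat.of R PUnit, inferInstanceAs (Module.IsTorsionFree R PUnit.{u + 1})⟩
  iso := isClosedUnderIsomorphisms_of_linearEquiv fun _ _ e (_ : Module.IsTorsionFree R _) =>
    e.symm.injective.moduleIsTorsionFree e.symm e.symm.map_smul
  subobjects X Y (_ : Module.IsTorsionFree R X) := inferInstanceAs (Module.IsTorsionFree R Y)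
  extensions L M N f g hf hfg hg (hL : Module.IsTorsionFree R L) (hN : Module.IsTorsionFree R N) := by
    refine Module.IsTorsionFree.of_smul_eq_zero fun r m hrm => or_iff_not_imp_left.2 fun hr => ?_
    have h1 : g m = 0 := by
      have := congrArg g hrm
      rw [map_smul, map_zero] at this
      exact (smul_eq_zero.1 this).resolve_left hr
    obtain ⟨l, rfl⟩ := (hfg m).1 h1
    rw [← map_smul, ← map_zero f] at hrm
    rw [(smul_eq_zero.1 (hf hrm)).resolve_left hr, map_zero]

theorem isTorsionfree_top : IsTorsionfree (⊤ : ObjectProperty (FGModuleCat.{u} R)) where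
  nonempty := ⟨FGModuleCat.of R PUnit, trivial⟩
  iso := isClosedUnderIsomorphisms_of_linearEquiv fun _ _ _ _ => trivial
  subobjects _ _ _ := trivial
  extensions _ _ _ _ _ _ _ _ _ _ := trivial

end IKE

end ModSubcategory

/-! ### Torsion and finite length in dimension one. -/

/-- A finitely generated torsion module over a one-dimensional noetherian domain has finite
length. -/
theorem Module.IsTorsionBy.isFiniteLength_of_ne_zero {R : Type*} [CommRing R] [IsDomain R] [IsNoetherianRing R]
    [Ring.KrullDimLE 1 R] {M : Type*} [AddCommGroup M] [Module R M] [Module.Finite R M] {a : R}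
    (ha : a ≠ 0) (h : Module.IsTorsionBy R M a) : IsFiniteLength R M := by
  have hR := isFiniteLength_quotient_span_singleton R (mem_nonZeroDivisors_of_ne_zero ha)
  rw [isFiniteLength_iff_isNoetherian_isArtinian] at hR
  have hR2 := hR.2
  have : IsArtinianRing (R ⧸ Ideal.span {a}) := isArtinian_of_tower R inferInstance
  let _ : Module (R ⧸ Ideal.span {a}) M := Module.IsTorsionBy.module h
  have : IsScalarTower R (R ⧸ Ideal.span {a}) M := Module.IsTorsionBySet.isScalarTower _
  have : Module.Finite (R ⧸ Ideal.span {a}) M := Module.Finite.of_restrictScalars_finite R _ _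
  rw [isFiniteLength_iff_isNoetherian_isArtinian]
  exact ⟨inferInstance, isArtinian_of_surjective_algebraMap
    (Ideal.Quotient.mk_surjective (I := Ideal.span {a}))⟩

/-- Such an `a` serves twice: it shows that the torsion submodule has finite length, and it makes
`aM` torsionfree. -/
theorem Submodule.exists_ne_zero_isTorsionBy_torsion (R : Type*) [CommRing R] [IsDomain R]
    [IsNoetherianRing R] (M : Type*) [AddCommGroup M] [Module R M] [Module.Finite R M] :
    ∃ a : R, a ≠ 0 ∧ ∀ m ∈ Submodule.torsion R M, a • m = 0 := by
  obtain ⟨a, ha, ha0⟩ := Submodule.annihilator_top_inter_nonZeroDivisors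
    (Submodule.torsion_isTorsion (R := R) (M := M))
  exact ⟨a, nonZeroDivisors.ne_zero ha0, fun m hm =>
    congrArg Subtype.val (Submodule.mem_annihilator.1 ha ⟨m, hm⟩ Submodule.mem_top)⟩

/-- A torsionfree module of finite length over a local domain that is not a field vanishes. -/
theorem Module.IsTorsionFree.subsingleton_of_isFiniteLength {R : Type*} [CommRing R] [IsDomain R]
    [IsLocalRing R] (hR : ¬ IsField R) {M : Type*} [AddCommGroup M] [Module R M]
    (hM : Module.IsTorsionFree R M) (h : IsFiniteLength R M) : Subsingleton M := by
  rw [isFiniteLength_iff_isNoetherian_isArtinian] at h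
  have := h.1
  have := h.2
  obtain ⟨x, hxm, hx⟩ : ∃ x ∈ IsLocalRing.maximalIdeal R, x ≠ 0 :=
    Submodule.exists_mem_ne_zero_of_ne_bot fun h0 => hR (IsLocalRing.isField_iff_maximalIdeal_eq.2 h0)
  -- An injective endomorphism of an artinian module is surjective, so `M = xM` and Nakayama's lemma
  -- applies.
  have hinj : Function.Injective (LinearMap.lsmul R M x) := smul_right_injective M hx
  have hsurj := IsArtinian.surjective_of_injective_endomorphism _ hinj
  have htop : (⊤ : Submodule R M) = ⊥ := by
    refine Submodule.eq_bot_of_le_smul_of_le_jacobson_bot (IsLocalRing.maximalIdeal R) _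
      (IsNoetherian.noetherian _) (fun m _ => ?_) (IsLocalRing.maximalIdeal_le_jacobson _)
    obtain ⟨n, rfl⟩ := hsurj m
    exact Submodule.smul_mem_smul hxm Submodule.mem_top
  exact (Submodule.subsingleton_iff R).1 (subsingleton_iff_bot_eq_top.1 htop.symm)

/-! ### Classification of the IKE-closed subcategories. -/

namespace ModSubcategory

variable {R : Type u} [CommRing R]

theorem HomIdeal.normalization_mem [IsDomain R] [IsNoetherianRing R] [IsLocalRing R]
    [Ring.KrullDimLE 1 R] [Module.Finite R (Normalization R)]
    {𝒳 : ObjectProperty (FGModuleCat.{u} R)}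
    (hhom : HomIdeal 𝒳) (hsum : ClosedUnderSummands 𝒳) {X : FGModuleCat.{u} R} (hX : 𝒳 X)
    [Nontrivial X] [Module.IsTorsionFree R X] : 𝒳 (FGModuleCat.of R (Normalization R)) := by
  have h := hhom (FGModuleCat.of R (Normalization R)) X hX
  obtain ⟨n, ⟨e⟩⟩ := Normalization.exists_linearMap_equiv_prod R X
  exact hsum _ (FGModuleCat.of R (Normalization R))
    (FGModuleCat.of R (Fin n → Normalization R)) e h

namespace IsIKEClosed

variable [IsDomain R] [IsNoetherianRing R] [IsLocalRing R] [Ring.KrullDimLE 1 R]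
  {𝒳 : ObjectProperty (FGModuleCat.{u} R)} (h : IsIKEClosed 𝒳)

include h

open IsLocalRing

/-- An IKE-closed subcategory with an object that is not torsionfree contains the residue field. -/
theorem residue_mem {X : FGModuleCat.{u} R} (hX : 𝒳 X) (hXt : ¬ Module.IsTorsionFree R X) :
    𝒳 (FGModuleCat.of R (R ⧸ maximalIdeal R)) := by
  obtain ⟨r, x, hr, hx, hrx⟩ : ∃ (r : R) (x : X), r ≠ 0 ∧ x ≠ 0 ∧ r • x = 0 := by
    by_contra! hc
    exact hXt (Module.IsTorsionFree.of_smul_eq_zero fun r x hrx =>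
      or_iff_not_imp_left.2 fun hr => by_contra fun hx => hc r x hr hx hrx)
  -- An associated prime containing the annihilator of `x` contains `r ≠ 0`, so in dimension one it
  -- is the maximal ideal.
  obtain ⟨P, hP, hle⟩ := exists_le_isAssociatedPrime_of_isNoetherianRing R x hx
  rw [isAssociatedPrime_iff] at hP
  obtain ⟨hPp, y, hy⟩ := hP
  have hrP : r ∈ P := hle (by simpa using hrx)
  have hPm : P = maximalIdeal R := eq_maximalIdeal
    (Ring.krullDimLE_one_iff_of_noZeroDivisors.1 inferInstance P
      (fun h0 => hr (by simpa [h0] using hrP)) hPp)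
  have hmem : ∀ a, a ∈ maximalIdeal R ↔ a • y = 0 := fun a => by
    rw [← hPm, hy]
    simp
  have hy0 : y ≠ 0 := by
    rintro rfl
    exact (maximalIdeal.isMaximal R).ne_top ((Ideal.eq_top_iff_one _).2 ((hmem 1).2 (smul_zero _)))
  have h1 := h.homIdeal (FGModuleCat.of R (R ⧸ maximalIdeal R)) X hX
  change 𝒳 (FGModuleCat.of R ((R ⧸ maximalIdeal R) →ₗ[R] X)) at h1
  -- `Hom(k, X)`, with `k` the residue field, is a nonzero finite-dimensional `k`-vector space, so
  -- it has `k` as a summand.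
  have hnt : Nontrivial ((R ⧸ maximalIdeal R) →ₗ[R] X) := by
    refine ⟨(maximalIdeal R).liftQ (LinearMap.toSpanSingleton R X y) fun a ha => (hmem a).1 ha, 0,
      fun h0 => hy0 ?_⟩
    have := LinearMap.congr_fun h0 (Submodule.Quotient.mk 1)
    change (1 : R) • y = 0 at this
    simpa using this
  have htors : Module.IsTorsionBySet R ((R ⧸ maximalIdeal R) →ₗ[R] X) (maximalIdeal R) := by
    rintro f ⟨a, ha⟩
    refine LinearMap.ext fun z => ?_
    obtain ⟨z, rfl⟩ := Ideal.Quotient.mk_surjective z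
    change a • f _ = 0
    rw [← map_smul, ← Ideal.Quotient.mk_eq_mk, ← Submodule.Quotient.mk_smul,
      show (Submodule.Quotient.mk (a • z) : R ⧸ maximalIdeal R) = 0 from
        (Submodule.Quotient.mk_eq_zero _).2 (Ideal.mul_mem_right z _ ha), map_zero]
  let _ : Module (R ⧸ maximalIdeal R) ((R ⧸ maximalIdeal R) →ₗ[R] X) := htors.module
  have : IsScalarTower R (R ⧸ maximalIdeal R) ((R ⧸ maximalIdeal R) →ₗ[R] X) :=
    htors.isScalarTower
  have : Module.Finite (R ⧸ maximalIdeal R) ((R ⧸ maximalIdeal R) →ₗ[R] X) :=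
    Module.Finite.of_restrictScalars_finite R _ _
  let _ : Field (R ⧸ maximalIdeal R) := Ideal.Quotient.field _
  have : Module.Free (R ⧸ maximalIdeal R) ((R ⧸ maximalIdeal R) →ₗ[R] X) :=
    Module.Free.of_divisionRing _ _
  obtain ⟨n, ⟨e⟩⟩ := Module.Free.exists_linearEquiv_prod R (R ⧸ maximalIdeal R)
    ((R ⧸ maximalIdeal R) →ₗ[R] X)
  exact h.closedUnderSummands _ (FGModuleCat.of R (R ⧸ maximalIdeal R))
    (FGModuleCat.of R (Fin n → R ⧸ maximalIdeal R)) e h1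

-- Induction along a composition series, whose factors are all the residue field because `R` is
-- local.
omit [IsDomain R] [Ring.KrullDimLE 1 R] in
theorem fl_le (hk : 𝒳 (FGModuleCat.of R (R ⧸ maximalIdeal R))) {M : FGModuleCat.{u} R}
    (hM : fl R M) : 𝒳 M := by
  have key : ∀ (M : Type u) [AddCommGroup M] [Module R M], IsFiniteLength R M →
      ∀ _ : Module.Finite R M, 𝒳 (FGModuleCat.of R M) := by
    intro M _ _ hM
    induction hM with
    | of_subsingleton =>
      intro _
      exact h.of_subsingleton _
    | @of_simple_quotient M _ _ N hs _ ih =>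
      intro _
      obtain ⟨I, hI, ⟨e⟩⟩ := isSimpleModule_iff_quot_maximal.1 hs
      obtain rfl := eq_maximalIdeal hI
      exact h.extensions (FGModuleCat.of R N) (FGModuleCat.of R M) (FGModuleCat.of R (M ⧸ N))
        N.subtype N.mkQ N.injective_subtype (LinearMap.exact_subtype_mkQ N) N.mkQ_surjective
        (ih inferInstance)
        (h.of_linearEquiv (X := FGModuleCat.of R (R ⧸ maximalIdeal R)) e.symm hk)
  exact key M hM M.property

omit [IsLocalRing R] in
/-- An IKE-closed subcategory with an object of infinite length contains a nonzero torsionfree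
module. -/
theorem exists_isTorsionFree {X : FGModuleCat.{u} R} (hX : 𝒳 X) (hXl : ¬ IsFiniteLength R X) :
    ∃ Y : FGModuleCat.{u} R, 𝒳 Y ∧ Nontrivial Y ∧ Module.IsTorsionFree R Y := by
  obtain ⟨a, ha, hat⟩ := Submodule.exists_ne_zero_isTorsionBy_torsion R X
  -- The submodule `aX` is `X` modulo its torsion; if it vanished, `a` would kill `X` and `X` would
  -- have finite length.
  refine ⟨_, h.images X X (LinearMap.lsmul R X a) hX hX, ?_, ?_⟩
  · refine Submodule.nontrivial_iff_ne_bot.2 fun h0 => hXl ?_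
    refine Module.IsTorsionBy.isFiniteLength_of_ne_zero ha fun x => ?_
    exact LinearMap.congr_fun (LinearMap.range_eq_bot.1 h0) x
  · refine Module.IsTorsionFree.of_smul_eq_zero fun r z hrz => or_iff_not_imp_left.2 fun hr => ?_
    obtain ⟨_, x, rfl⟩ := z
    have h1 : r • a • x = 0 := congrArg Subtype.val hrz
    rw [smul_smul] at h1
    exact Subtype.ext (hat x ⟨⟨r * a, mem_nonZeroDivisors_of_ne_zero (mul_ne_zero hr ha)⟩, h1⟩)

-- Every `M` is an extension of the torsionfree module `M / torsion` by its torsion submodule, which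
-- has finite length.
omit [IsLocalRing R] in
theorem eq_top_of_fl_le_of_tf_le (hfl : ∀ M, fl R M → 𝒳 M) (htf : ∀ M, tf R M → 𝒳 M) : 𝒳 = ⊤ := by
  refine top_le_iff.1 fun M _ => ?_
  obtain ⟨a, ha, hat⟩ := Submodule.exists_ne_zero_isTorsionBy_torsion R M
  refine h.extensions (FGModuleCat.of R (Submodule.torsion R M)) M
    (FGModuleCat.of R (M ⧸ Submodule.torsion R M)) (Submodule.torsion R M).subtype
    (Submodule.torsion R M).mkQ (Submodule.injective_subtype _) (LinearMap.exact_subtype_mkQ _)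
    (Submodule.mkQ_surjective _) (hfl _ ?_) (htf _ ?_)
  · exact Module.IsTorsionBy.isFiniteLength_of_ne_zero ha fun x => Subtype.ext (hat x x.2)
  · exact inferInstanceAs (Module.IsTorsionFree R (M ⧸ Submodule.torsion R M))

/-- If the conductor generates `tf R`, then there are only four IKE-closed subcategories. -/
theorem eq_zero_or_fl_or_tf_or_top [Module.Finite R (Normalization R)] (hR : ¬ IsField R)
    (hc : ext (FGModuleCat.of R (conductorIdeal R)) = tf R) :
    𝒳 = zero R ∨ 𝒳 = fl R ∨ 𝒳 = tf R ∨ 𝒳 = ⊤ := by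
  by_cases h0 : 𝒳 ≤ zero R
  · exact .inl (le_antisymm h0 fun M (_ : Subsingleton M) => h.of_subsingleton M)
  right
  have htf : (∃ X, 𝒳 X ∧ ¬ IsFiniteLength R X) → ∀ M, tf R M → 𝒳 M := by
    rintro ⟨X, hX, hXl⟩ M hM
    obtain ⟨Y, hY, _, _⟩ := h.exists_isTorsionFree hX hXl
    have hS := HomIdeal.normalization_mem h.homIdeal h.closedUnderSummands hY
    obtain ⟨e⟩ := nonempty_conductorIdeal_linearEquiv R
    rw [← hc] at hM
    exact h.ext_le (h.of_linearEquiv (X := FGModuleCat.of R (Normalization R))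
      (Y := FGModuleCat.of R (conductorIdeal R)) e hS) hM
  by_cases hf : 𝒳 ≤ fl R
  · left
    refine le_antisymm hf fun M hM => ?_
    obtain ⟨X, hX, hX0⟩ : ∃ X, 𝒳 X ∧ ¬ Subsingleton X := by
      by_contra! hcon
      exact h0 fun X hX => hcon X hX
    -- A nonzero module of finite length cannot be torsionfree, so it puts the residue field into
    -- the subcategory.
    exact h.fl_le (h.residue_mem hX fun hXt => hX0 (hXt.subsingleton_of_isFiniteLength hR (hf X hX)))
      hM
  right
  have htf' := htf (by
    by_contra! hcon
    exact hf fun X hX => hcon X hX)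
  by_cases ht : 𝒳 ≤ tf R
  · exact .inl (le_antisymm ht htf')
  right
  obtain ⟨X, hX, hXt⟩ : ∃ X, 𝒳 X ∧ ¬ Module.IsTorsionFree R X := by
    by_contra! hcon
    exact ht fun X hX => hcon X hX
  exact h.eq_top_of_fl_le_of_tf_le (fun M hM => h.fl_le (h.residue_mem hX hXt) hM) htf'

end IsIKEClosed

end ModSubcategory

theorem proposition4p11 (R : Type u) [CommRing R] [IsDomain R] [HenselianLocalRing R]
    [IsExcellentRing R] (hdim : ringKrullDim R = 1) :
    -- the normalization is an object of `mod R`, and it lies in every such subcategory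
    (∃ _ : Module.Finite R (Normalization R),
      ∀ 𝒳 : ObjectProperty (FGModuleCat.{u} R), 𝒳.IsClosedUnderIsomorphisms →
        ModSubcategory.HomIdeal 𝒳 → ModSubcategory.ClosedUnderSummands 𝒳 →
        (∃ X : FGModuleCat.{u} R, 𝒳 X ∧ Nontrivial X ∧ Module.IsTorsionFree R X) →
        𝒳 (FGModuleCat.of R (Normalization R))) ∧
    (ModSubcategory.ext (FGModuleCat.of R (conductorIdeal R)) = ModSubcategory.tf R →
      (∀ 𝒳 : ObjectProperty (FGModuleCat.{u} R), ModSubcategory.IsIKEClosed 𝒳 ↔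
        𝒳 = ModSubcategory.zero R ∨ 𝒳 = ModSubcategory.fl R ∨
          𝒳 = ModSubcategory.tf R ∨ 𝒳 = ⊤) ∧
      (∀ 𝒳 : ObjectProperty (FGModuleCat.{u} R), ModSubcategory.IsIKEClosed 𝒳 →
        ModSubcategory.IsTorsionfree 𝒳)) := by
  have hK : Ring.KrullDimLE 1 R := (Order.krullDimLE_iff _ _).2 hdim.le
  have hR : ¬ IsField R := fun h => by
    rw [ringKrullDim_eq_zero_of_isField h] at hdim
    exact zero_ne_one hdim
  have hS : Module.Finite R (Normalization R) :=
    Module.Finite.normalization_of_isExcellentRing R hdim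
  refine ⟨⟨hS, fun 𝒳 _ hhom hsum ⟨X, hX, _, _⟩ => hhom.normalization_mem hsum hX⟩, fun hc => ?_⟩
  have hclass : ∀ 𝒳 : ObjectProperty (FGModuleCat.{u} R), ModSubcategory.IsIKEClosed 𝒳 →
      𝒳 = ModSubcategory.zero R ∨ 𝒳 = ModSubcategory.fl R ∨ 𝒳 = ModSubcategory.tf R ∨ 𝒳 = ⊤ :=
    fun 𝒳 h => h.eq_zero_or_fl_or_tf_or_top hR hc
  have htf : ∀ 𝒳 : ObjectProperty (FGModuleCat.{u} R),
      (𝒳 = ModSubcategory.zero R ∨ 𝒳 = ModSubcategory.fl R ∨ 𝒳 = ModSubcategory.tf R ∨ 𝒳 = ⊤) →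
      ModSubcategory.IsTorsionfree 𝒳 := by
    rintro 𝒳 (rfl | rfl | rfl | rfl)
    · exact ModSubcategory.isTorsionfree_zero
    · exact ModSubcategory.isTorsionfree_fl
    · exact ModSubcategory.isTorsionfree_tf
    · exact ModSubcategory.isTorsionfree_top
  exact ⟨fun 𝒳 => ⟨hclass 𝒳, fun h => (htf 𝒳 h).isIKEClosed⟩, fun 𝒳 h => htf 𝒳 (hclass 𝒳 h)⟩
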